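/- **Setting.** Let $N\in\mathbb N$ and let $M$ be either $\mathbb R^N$ or the flat torus $\mathbb T^N=\mathbb R^N/\mathbb Z^N$, where $|x|$ denotes the Euclidean norm on $\mathbb R^N$, respectively the quotient norm $|x|=\min_{k\in\mathbb Z^N}|x+k|$ on $\mathbb T^N$. A function $g$ is *superlinear* if $g(h)/h\to+\infty$ as $h\to+\infty$. A *convex Hamiltonian* is a continuous function $H:M\times\mathbb R^N\to\mathbb R$ such that $p\mapsto H(x,p)$ is convex for every $x\in M$, and $\alpha(|p|)\le H(x,p)\le\beta(|p|)$ for all $(x,p)\in M\times\mathbb R^N$, for some superlinear functions $\alpha,\beta:[0,\infty)\to\mathbb R$. Its Lagrangian is $L_H(x,q)=\sup_{p\in\mathbb R^N}\{\langle p,q\rangle-H(x,p)\}$. An *admissible initial datum* is a function $u:M\to\mathbb R\cup\{+\infty\}$ such that $u\ge a|\cdot|+b$ on $M$ for some $a,b\in\mathbb R$. For $t>0$ set $$(S_H(t)u)(x)=\inf\Big\{u(\gamma(-t))+\int_{-t}^0L_H(\gamma(s),\dot\gamma(s))\,ds\;:\;\gamma:[-t,0]\to M\text{ absolutely continuous},\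 \gamma(0)=x\Big\}.$$ Two convex Hamiltonians $H,G$ *commute* if $S_G(s)(S_H(t)u)(x)=S_H(t)(S_G(s)u)(x)$ for all $s,t>0$, all $x\in M$ and all admissible initial data $u$. **Proposition.** Let $H_1$ and $H_2$ be two commuting convex Hamiltonians on $M\times\mathbb R^N$, and let $$G(x,p)=\max\{H_1(x,p),H_2(x,p)\}\qquad\text{for }(x,p)\in M\times\mathbb R^N.$$ Then $G$ is a convex Hamiltonian, and $G$ commutes both with $H_1$ and with $H_2$. -/

import Mathlib

open Filter MeasureTheory Topology

noncomputable section

namespace HJ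

/-- The Euclidean space `ℝ^N`. -/
abbrev Euc (N : ℕ) : Type := EuclideanSpace ℝ (Fin N)

/-- The lattice `ℤ^N` of vectors with integer coordinates in `ℝ^N`. -/
def intLattice (N : ℕ) : AddSubgroup (Euc N) where
  carrier := {x | ∀ i, ∃ k : ℤ, x i = (k : ℝ)}
  zero_mem' := fun _ => ⟨0, by simp⟩
  add_mem' := by
    intro x y hx hy i
    obtain ⟨k, hk⟩ := hx i
    obtain ⟨l, hl⟩ := hy i
    exact ⟨k + l, by simp [hk, hl]⟩
  neg_mem' := by
    intro x hx i
    obtain ⟨k, hk⟩ := hx i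
    exact ⟨-k, by simp [hk]⟩

/-- The flat torus `𝕋^N = ℝ^N / ℤ^N`, with the quotient norm, i.e. the Euclidean distance of a
representative to `ℤ^N`. -/
abbrev Torus (N : ℕ) : Type := Euc N ⧸ intLattice N

/-- The canonical projection `ℝ^N → 𝕋^N`. -/
def torusProj (N : ℕ) : Euc N → Torus N := fun x => (x : Euc N ⧸ intLattice N)

/-- Superlinearity of a function on `[0, ∞)` (its values at negative numbers are irrelevant). -/
def Superlinear (g : ℝ → ℝ) : Prop := Tendsto (fun h => g h / h) atTop atTop

section

variable {N : ℕ} {M : Type} [SeminormedAddCommGroup M]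

/-- Convex Hamiltonians on `M × ℝ^N`: continuous, convex in the momentum, and bounded from below
and from above by superlinear functions of `|p|`, uniformly in `x`. -/
structure IsConvexHamiltonian (H : M → Euc N → ℝ) : Prop where
  continuous : Continuous fun z : M × Euc N => H z.1 z.2
  convex : ∀ x, ConvexOn ℝ Set.univ (H x)
  growth : ∃ α β : ℝ → ℝ, Superlinear α ∧ Superlinear β ∧
    ∀ x p, α ‖p‖ ≤ H x p ∧ H x p ≤ β ‖p‖

/-- The Lagrangian of `H`: `L(x, q) = sup_p (⟨p, q⟩ - H(x, p))`. For a convex Hamiltonian the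
supremum is that of a nonempty bounded above set. -/
def lagrangian (H : M → Euc N → ℝ) (x : M) (q : Euc N) : ℝ :=
  ⨆ p : Euc N, (inner ℝ p q - H x p)

/-- The action `∫_{-t}^0 L(γ, γ') ds ∈ (-∞, +∞]` of the curve `γ = π ∘ η` in `M`, where `η` is an
absolutely continuous curve in `ℝ^N`, and `π : ℝ^N → M` is the projection (a local isometry, so
that the velocity of `γ` is that of `η`). For a convex Hamiltonian the integrand is measurable and
bounded from below, so its integral is `+∞` when it is not integrable. -/
def action (π : Euc N → M) (H : M → Euc N → ℝ) (t : ℝ) (η : ℝ → Euc N) : EReal :=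
  open Classical in
  if IntervalIntegrable (fun s => lagrangian H (π (η s)) (deriv η s)) volume (-t) 0 then
    ((∫ s in (-t)..0, lagrangian H (π (η s)) (deriv η s) : ℝ) : EReal)
  else ⊤

/-- The Lax-Oleinik operator
`(S(t)u)(x) = inf {u(γ(-t)) + ∫_{-t}^0 L(γ, γ') ds : γ ∈ W^{1,1}([-t,0]; M), γ(0) = x}`.
The absolutely continuous curves `γ` in `M` are written as `γ = π ∘ η` with `η` an absolutely
continuous curve in `ℝ^N`; here `M` is `ℝ^N`, with `π` the identity, or `𝕋^N`, with `π` the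
canonical projection. -/
def laxOleinik (π : Euc N → M) (H : M → Euc N → ℝ) (t : ℝ) (u : M → EReal) (x : M) : EReal :=
  ⨅ η ∈ {η : ℝ → Euc N | AbsolutelyContinuousOnInterval η (-t) 0 ∧ π (η 0) = x},
    (u (π (η (-t))) + action π H t η)

/-- Admissible initial data: functions `u : M → ℝ ∪ {+∞}` with `u ≥ a|·| + b` for some real `a`,
`b` (in particular `u` never takes the value `-∞`). -/
def Admissible (u : M → EReal) : Prop :=
  ∃ a b : ℝ, ∀ x, ((a * ‖x‖ + b : ℝ) : EReal) ≤ u x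

/-- `H` and `G` commute: their Lax-Oleinik semigroups commute on all admissible initial data. -/
def Commute (π : Euc N → M) (H G : M → Euc N → ℝ) : Prop :=
  ∀ u : M → EReal, Admissible u → ∀ s t : ℝ, 0 < s → 0 < t → ∀ x : M,
    laxOleinik π G s (laxOleinik π H t u) x = laxOleinik π H t (laxOleinik π G s u) x

end

end HJ

end

/-!
Let `S_i` be the Lax-Oleinik semigroup of `H_i`, and let `G = max H₁ H₂`. The heart of the matter is
the formula

  `S_G(t) u = ⨅ r ∈ [0, t], S_1(r) (S_2(t - r) u)`    (`HJ.Commute.laxOleinik_max`).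

It implies the result: the operators `S_i` commute with infima, so that applying `S_1(s)` before or
after `S_G(t)` amounts to adding `s` to the time spent with `H₁`.

The inequality `≤` in the formula holds because `L_G ≤ L_i`, and because `S_G` is a semigroup. For
`≥`, a curve of finite action for `L_G` has to be replaced by one that uses `L₁` and `L₂` in turn. This
rests on two facts.

* *Splitting* (`HJ.IsConvexHamiltonian.exists_split_velocity`). A velocity `v` is a convex
  combination `l q₁ + (1 - l) q₂` with `l L₁(x, q₁) + (1 - l) L₂(x, q₂) ≤ L_G(x, v)`. Indeed, if `p₀`
  is the momentum dual to `v`, then `v` is a subgradient of `max H₁ H₂` at `p₀`, hence (Gordan's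
  alternative) of a convex combination `l H₁ + (1 - l) H₂`, hence (sandwich theorem) a combination
  of subgradients of `H₁` and `H₂` at `p₀`.
* *Polygonal approximation* (`HJ.IsConvexHamiltonian.exists_polygon`). A curve of finite action may be
  unboundedly fast, while `L_G(x, q)` is continuous in `x` only locally uniformly in `q`. The curve is
  therefore replaced by an inscribed polygon, in which the fast edges are slowed down to a speed `R`,
  and the lost time is made up for on the other edges. If `p` is dual to the velocity `v` of an
  edge travelled in time `σ`, then `σ L_G(x, v) = ⟨p, Δ⟩ - σ G(x, p)`, while the action of the curve
  over a time step `h` with displacement `Δ = σ v` is at least `⟨p, Δ⟩ - h max G(·, p)`. The loss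
  `(h - σ) G(x, p)` is small in total: `G` is bounded below, and where `h > σ` the edge is slow, so that
  `G(x, p)` is bounded independently of `R`.

Each edge of the polygon is then travelled first with velocity `q₂` at the cost `L₂`, then with
velocity `q₁` at the cost `L₁` (`HJ.Commute.exists_forall_edge`), and commutation gathers the times
spent with `H₁` and with `H₂`. Both `ℝ^N` and the torus are covered by working with curves in `ℝ^N`
and an additive, norm-nonincreasing, surjective map `π : ℝ^N → M` (`HJ.IsProjection`).
-/

namespace HJ

/-! ### Hamiltonians and their Lagrangians -/

section Lagrangian

variable {N : ℕ} {M : Type} [SeminormedAddCommGroup M] {H : M → Euc N → ℝ}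

lemma IsConvexHamiltonian.continuous_right (hH : IsConvexHamiltonian H) (x : M) :
    Continuous (H x) :=
  hH.continuous.comp (Continuous.prodMk_right x)

/-- A superlinear function eventually dominates every affine function. -/
lemma Superlinear.exists_forall_lt {α : ℝ → ℝ} (hα : Superlinear α) (R b : ℝ) :
    ∃ P : ℝ, 0 ≤ P ∧ ∀ h, P < h → R * h + b < α h := by
  obtain ⟨P, hP⟩ := eventually_atTop.1 (hα.eventually_gt_atTop (R + |b|))
  refine ⟨max P 1, by positivity, fun h hh => ?_⟩
  have h1 : 1 < h := (le_max_right _ _).trans_lt hh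
  have h2 := hP h ((le_max_left _ _).trans hh.le)
  rw [lt_div_iff₀ (by linarith)] at h2
  have h3 : b ≤ |b| * h := (le_abs_self b).trans (le_mul_of_one_le_right (abs_nonneg b) h1.le)
  nlinarith

/-- Momenta that do at least as well as `p = 0` in the supremum defining `L(x, q)` are bounded,
uniformly in `x` and locally uniformly in `q`. -/
lemma IsConvexHamiltonian.exists_norm_le (hH : IsConvexHamiltonian H) (R : ℝ) :
    ∃ P : ℝ, 0 ≤ P ∧ ∀ x q, ‖q‖ ≤ R → ∀ p, -H x 0 ≤ inner ℝ p q - H x p → ‖p‖ ≤ P := by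
  obtain ⟨α, β, hα, -, hαβ⟩ := hH.growth
  obtain ⟨P, hP0, hP⟩ := hα.exists_forall_lt R (β 0)
  refine ⟨P, hP0, fun x q hq p hp => ?_⟩
  by_contra! hlt
  have h1 := hP _ hlt
  have h2 := (hαβ x p).1
  have h3 := (hαβ x 0).2
  rw [norm_zero] at h3
  have h4 : inner ℝ p q ≤ R * ‖p‖ :=
    (real_inner_le_norm p q).trans (by rw [mul_comm]; gcongr)
  linarith

lemma IsConvexHamiltonian.exists_isMaxOn (hH : IsConvexHamiltonian H) (x : M) (q : Euc N) :
    ∃ p, ∀ p', inner ℝ p' q - H x p' ≤ inner ℝ p q - H x p := by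
  obtain ⟨P, hP0, hP⟩ := hH.exists_norm_le ‖q‖
  have hc : Continuous fun p : Euc N => inner ℝ p q - H x p :=
    (continuous_id.inner continuous_const).sub (hH.continuous_right x)
  obtain ⟨p, -, hp⟩ := (isCompact_closedBall (0 : Euc N) P).exists_isMaxOn
    ⟨0, by simpa using hP0⟩ hc.continuousOn
  refine ⟨p, fun p' => ?_⟩
  by_cases h : -H x 0 ≤ inner ℝ p' q - H x p'
  · exact hp (by simpa using hP x q le_rfl p' h)
  · have h0 := hp (show (0 : Euc N) ∈ Metric.closedBall 0 P by simpa using hP0)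
    simp only [Set.mem_ofPred_eq, inner_zero_left] at h0
    linarith

lemma IsConvexHamiltonian.bddAbove (hH : IsConvexHamiltonian H) (x : M) (q : Euc N) :
    BddAbove (Set.range fun p : Euc N => inner ℝ p q - H x p) := by
  obtain ⟨p, hp⟩ := hH.exists_isMaxOn x q
  exact ⟨_, by rintro _ ⟨p', rfl⟩; exact hp p'⟩

lemma IsConvexHamiltonian.le_lagrangian (hH : IsConvexHamiltonian H) (x : M) (p q : Euc N) :
    inner ℝ p q - H x p ≤ lagrangian H x q :=
  le_ciSup (hH.bddAbove x q) p

lemma IsConvexHamiltonian.exists_lagrangian_eq (hH : IsConvexHamiltonian H) (x : M) (q : Euc N) :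
    ∃ p, lagrangian H x q = inner ℝ p q - H x p := by
  obtain ⟨p, hp⟩ := hH.exists_isMaxOn x q
  exact ⟨p, le_antisymm (ciSup_le hp) (hH.le_lagrangian x p q)⟩

/-- The momenta dual to bounded velocities are bounded. -/
lemma IsConvexHamiltonian.exists_norm_le_of_lagrangian_eq (hH : IsConvexHamiltonian H) (R : ℝ) :
    ∃ P : ℝ, 0 ≤ P ∧ ∀ x q, ‖q‖ ≤ R → ∀ p, lagrangian H x q = inner ℝ p q - H x p → ‖p‖ ≤ P := by
  obtain ⟨P, hP0, hP⟩ := hH.exists_norm_le R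
  refine ⟨P, hP0, fun x q hq p hp => hP x q hq p ?_⟩
  simpa [← hp] using hH.le_lagrangian x 0 q

lemma IsConvexHamiltonian.exists_neg_le_lagrangian (hH : IsConvexHamiltonian H) :
    ∃ C : ℝ, ∀ x q, -C ≤ lagrangian H x q := by
  obtain ⟨α, β, -, -, hαβ⟩ := hH.growth
  refine ⟨β 0, fun x q => ?_⟩
  have h1 := hH.le_lagrangian x 0 q
  have h2 := (hαβ x 0).2
  rw [norm_zero] at h2
  rw [inner_zero_left] at h1
  linarith

lemma IsConvexHamiltonian.lowerSemicontinuous_lagrangian (hH : IsConvexHamiltonian H) :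
    LowerSemicontinuous fun z : M × Euc N => lagrangian H z.1 z.2 := by
  refine lowerSemicontinuous_ciSup (fun z => hH.bddAbove z.1 z.2) fun p => ?_
  refine Continuous.lowerSemicontinuous ?_
  exact (continuous_const.inner continuous_snd).sub
    (hH.continuous.comp (continuous_fst.prodMk continuous_const))

lemma lagrangian_anti {G : M → Euc N → ℝ} (hH : IsConvexHamiltonian H)
    (hle : ∀ x p, H x p ≤ G x p) (x : M) (q : Euc N) : lagrangian G x q ≤ lagrangian H x q :=
  ciSup_mono (hH.bddAbove x q) fun p => sub_le_sub_left (hle x p) _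

/-- The maximum of two convex Hamiltonians is a convex Hamiltonian. -/
lemma IsConvexHamiltonian.sup {H₁ H₂ : M → Euc N → ℝ} (h₁ : IsConvexHamiltonian H₁)
    (h₂ : IsConvexHamiltonian H₂) :
    IsConvexHamiltonian fun x p => max (H₁ x p) (H₂ x p) where
  continuous := h₁.continuous.max h₂.continuous
  convex x := (h₁.convex x).sup (h₂.convex x)
  growth := by
    obtain ⟨α₁, β₁, hα₁, hβ₁, hH₁⟩ := h₁.growth
    obtain ⟨α₂, β₂, hα₂, hβ₂, hH₂⟩ := h₂.growth
    refine ⟨α₁, fun h => max (β₁ h) (β₂ h), hα₁, ?_, fun x p =>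
      ⟨(hH₁ x p).1.trans (le_max_left _ _), max_le_max (hH₁ x p).2 (hH₂ x p).2⟩⟩
    refine tendsto_atTop_mono' _ ?_ hβ₁
    filter_upwards [eventually_gt_atTop 0] with h hh
    gcongr
    exact le_max_left _ _

/-- A convex Hamiltonian is uniformly continuous in `x` on compact sets. -/
lemma IsConvexHamiltonian.exists_modulus (hH : IsConvexHamiltonian H) {X : Set M}
    (hX : IsCompact X) (P : ℝ) {ε : ℝ} (hε : 0 < ε) :
    ∃ δ > 0, ∀ x ∈ X, ∀ y ∈ X, dist x y < δ → ∀ p, ‖p‖ ≤ P → H x p ≤ H y p + ε := by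
  have hu := (hX.prod (isCompact_closedBall (0 : Euc N) P)).uniformContinuousOn_of_continuous
    hH.continuous.continuousOn
  obtain ⟨δ, hδ, h⟩ := Metric.uniformContinuousOn_iff.1 hu ε hε
  refine ⟨δ, hδ, fun x hx y hy hxy p hp => ?_⟩
  have := h (x, p) ⟨hx, by simpa using hp⟩ (y, p) ⟨hy, by simpa using hp⟩
    (by simpa [Prod.dist_eq, hδ] using hxy)
  rw [Real.dist_eq] at this
  linarith [(abs_lt.1 this).2]

lemma IsConvexHamiltonian.exists_lagrangian_modulus (hH : IsConvexHamiltonian H) {X : Set M}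
    (hX : IsCompact X) (R : ℝ) {ε : ℝ} (hε : 0 < ε) :
    ∃ δ > 0, ∀ x ∈ X, ∀ y ∈ X, dist x y < δ → ∀ q, ‖q‖ ≤ R →
      lagrangian H x q ≤ lagrangian H y q + ε := by
  obtain ⟨P, -, hP⟩ := hH.exists_norm_le_of_lagrangian_eq R
  obtain ⟨δ, hδ, h⟩ := hH.exists_modulus hX P hε
  refine ⟨δ, hδ, fun x hx y hy hxy q hq => ?_⟩
  obtain ⟨p, hp⟩ := hH.exists_lagrangian_eq x q
  have h1 := h y hy x hx (by rwa [dist_comm]) p (hP x q hq p hp)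
  have h2 := hH.le_lagrangian y p q
  linarith

lemma IsConvexHamiltonian.exists_abs_le (hH : IsConvexHamiltonian H) {X : Set M}
    (hX : IsCompact X) (P : ℝ) :
    ∃ K : ℝ, 0 ≤ K ∧ ∀ x ∈ X, ∀ p, ‖p‖ ≤ P → |H x p| ≤ K := by
  obtain ⟨K, hK⟩ := (hX.prod (isCompact_closedBall (0 : Euc N) P)).exists_bound_of_continuousOn
    hH.continuous.continuousOn
  refine ⟨max K 0, le_max_right _ _, fun x hx p hp => ?_⟩
  exact (hK (x, p) ⟨hx, by simpa using hp⟩).trans (le_max_left _ _)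

lemma IsConvexHamiltonian.exists_neg_le (hH : IsConvexHamiltonian H) {X : Set M}
    (hX : IsCompact X) : ∃ C : ℝ, 0 ≤ C ∧ ∀ x ∈ X, ∀ p, -C ≤ H x p := by
  obtain ⟨P, -, hP⟩ := hH.exists_norm_le_of_lagrangian_eq 0
  obtain ⟨C, hC0, hC⟩ := hH.exists_abs_le hX P
  refine ⟨C, hC0, fun x hx p => ?_⟩
  obtain ⟨p₀, hp₀⟩ := hH.exists_lagrangian_eq x 0
  have h1 := hH.le_lagrangian x p 0
  have h2 := (abs_le.1 (hC x hx p₀ (hP x 0 (by simp) p₀ hp₀))).1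
  simp only [inner_zero_right] at h1 hp₀
  linarith

end Lagrangian

/-! ### Splitting velocities for the maximum of two Hamiltonians -/

section Convex

/-- **Gordan's alternative** for two convex functions: if their maximum is nonnegative, then so is
one of their convex combinations. -/
lemma exists_convexCombination_nonneg {E : Type*} [AddCommGroup E] [Module ℝ E] {f g : E → ℝ}
    (hf : ConvexOn ℝ Set.univ f) (hg : ConvexOn ℝ Set.univ g) (h : ∀ p, 0 ≤ max (f p) (g p)) :
    ∃ l : ℝ, 0 ≤ l ∧ l ≤ 1 ∧ ∀ p, 0 ≤ l * f p + (1 - l) * g p := by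
  -- Separate the origin from the open convex set of pairs dominating some `(f p, g p)`.
  let S : Set (ℝ × ℝ) := {z | ∃ p, f p < z.1 ∧ g p < z.2}
  have hSo : IsOpen S := by
    have : S = ⋃ p, Set.Ioi (f p) ×ˢ Set.Ioi (g p) := by ext; simp [S]
    rw [this]
    exact isOpen_iUnion fun p => isOpen_Ioi.prod isOpen_Ioi
  have hSc : Convex ℝ S := by
    rintro ⟨a, b⟩ ⟨p, hp⟩ ⟨c, d⟩ ⟨q, hq⟩ s t hs ht hst
    refine ⟨s • p + t • q, ?_, ?_⟩
    · refine (hf.2 trivial trivial hs ht hst).trans_lt ?_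
      simp only [smul_eq_mul, Prod.smul_mk, Prod.mk_add_mk] at hp hq ⊢
      rcases hs.eq_or_lt with rfl | hs
      · have : t = 1 := by linarith
        subst this; linarith
      · nlinarith
    · refine (hg.2 trivial trivial hs ht hst).trans_lt ?_
      simp only [smul_eq_mul, Prod.smul_mk, Prod.mk_add_mk] at hp hq ⊢
      rcases hs.eq_or_lt with rfl | hs
      · have : t = 1 := by linarith
        subst this; linarith
      · nlinarith
  have h0 : (0 : ℝ × ℝ) ∉ S := by
    rintro ⟨p, hp1, hp2⟩
    exact (h p).not_gt (max_lt hp1 hp2)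
  obtain ⟨φ, hφ⟩ := geometric_hahn_banach_open_point hSc hSo h0
  set a := φ (1, 0)
  set b := φ (0, 1)
  have hφab : ∀ x y : ℝ, φ (x, y) = x * a + y * b := fun x y => by
    have : ((x, y) : ℝ × ℝ) = x • (1, 0) + y • (0, 1) := by simp
    rw [this, map_add, map_smul, map_smul, smul_eq_mul, smul_eq_mul]
  have hlt : ∀ p x y, f p < x → g p < y → x * a + y * b < 0 := fun p x y hx hy => by
    simpa [hφab] using hφ (x, y) ⟨p, hx, hy⟩
  -- Both coordinates of the separating functional are nonpositive, as `S` is an upper set.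
  have ha : a ≤ 0 := by
    by_contra! ha
    have h1 := hlt 0 (max (f 0 + 1) ((|g 0 + 1| * |b|) / a)) (g 0 + 1)
      (lt_max_of_lt_left (by linarith)) (by linarith)
    have h2 : (|g 0 + 1| * |b|) ≤ max (f 0 + 1) ((|g 0 + 1| * |b|) / a) * a := by
      rw [← div_le_iff₀ ha]; exact le_max_right _ _
    have h3 := neg_abs_le ((g 0 + 1) * b)
    rw [abs_mul] at h3
    linarith
  have hb : b ≤ 0 := by
    by_contra! hb
    have h1 := hlt 0 (f 0 + 1) (max (g 0 + 1) ((|f 0 + 1| * |a|) / b))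
      (by linarith) (lt_max_of_lt_left (by linarith))
    have h2 : (|f 0 + 1| * |a|) ≤ max (g 0 + 1) ((|f 0 + 1| * |a|) / b) * b := by
      rw [← div_le_iff₀ hb]; exact le_max_right _ _
    have h3 := neg_abs_le ((f 0 + 1) * a)
    rw [abs_mul] at h3
    linarith
  have hab : a + b < 0 := by
    rcases ha.eq_or_lt with ha0 | ha0
    · rcases hb.eq_or_lt with hb0 | hb0
      · have := hlt 0 (f 0 + 1) (g 0 + 1) (by linarith) (by linarith)
        rw [ha0, hb0] at this
        simp at this
      · linarith
    · linarith
  have hle : ∀ p, f p * a + g p * b ≤ 0 := fun p => by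
    by_contra! hp
    have hs : 0 < -(a + b) := by linarith
    have h1 := hlt p (f p + (f p * a + g p * b) / -(a + b)) (g p + (f p * a + g p * b) / -(a + b))
      (by linarith [div_pos hp hs]) (by linarith [div_pos hp hs])
    have h2 : (f p * a + g p * b) / -(a + b) * -(a + b) = f p * a + g p * b :=
      div_mul_cancel₀ _ hs.ne'
    nlinarith
  refine ⟨a / (a + b), div_nonneg_of_nonpos ha hab.le, ?_, fun p => ?_⟩
  · rw [div_le_one_of_neg hab]; linarith
  · have : a / (a + b) * f p + (1 - a / (a + b)) * g p = (f p * a + g p * b) / (a + b) := by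
      have := hab.ne
      field_simp
      ring
    rw [this]
    exact div_nonneg_of_nonpos (hle p) hab.le

variable {E : Type*} [NormedAddCommGroup E] [InnerProductSpace ℝ E]

/-- **Sandwich theorem**: if `-g ≤ f` with equality at `p₀`, then an affine function with value
`f p₀` at `p₀` fits in between. -/
lemma exists_affine_between [CompleteSpace E] {f g : E → ℝ} (hf : ConvexOn ℝ Set.univ f)
    (hg : ConvexOn ℝ Set.univ g) (hfc : Continuous f) {p₀ : E} (h : ∀ p, 0 ≤ f p + g p)
    (h₀ : f p₀ + g p₀ = 0) :
    ∃ w : E, (∀ p, f p₀ + inner ℝ (p - p₀) w ≤ f p) ∧ ∀ p, g p₀ - inner ℝ (p - p₀) w ≤ g p := by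
  have hA : Convex ℝ {z : E × ℝ | z.1 ∈ Set.univ ∧ f z.1 < z.2} := hf.convex_strict_epigraph
  have hAo : IsOpen {z : E × ℝ | z.1 ∈ Set.univ ∧ f z.1 < z.2} := by
    simpa using isOpen_lt (hfc.comp continuous_fst) continuous_snd
  have hB : Convex ℝ {z : E × ℝ | z.1 ∈ Set.univ ∧ z.2 ≤ (-g) z.1} := hg.neg.convex_hypograph
  have hd : Disjoint {z : E × ℝ | z.1 ∈ Set.univ ∧ f z.1 < z.2}
      {z : E × ℝ | z.1 ∈ Set.univ ∧ z.2 ≤ (-g) z.1} := by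
    rw [Set.disjoint_left]
    rintro z ⟨-, h1⟩ ⟨-, h2⟩
    have := h z.1
    simp only [Pi.neg_apply] at h2
    linarith
  obtain ⟨φ, u, hφA, hφB⟩ := geometric_hahn_banach_open hA hAo hB hd
  set c := φ (0, 1)
  set ψ : E →L[ℝ] ℝ := φ.comp (ContinuousLinearMap.inl ℝ E ℝ)
  have hφ : ∀ p r, φ (p, r) = ψ p + r * c := fun p r => by
    have : ((p, r) : E × ℝ) = (p, 0) + r • (0, 1) := by simp
    rw [this, map_add, map_smul, smul_eq_mul]
    rfl
  have hA' : ∀ p r, f p < r → ψ p + r * c < u := fun p r hr => by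
    simpa [hφ] using hφA (p, r) ⟨trivial, hr⟩
  have hB' : ∀ p, u ≤ ψ p + -g p * c := fun p => by
    simpa [hφ] using hφB (p, -g p) ⟨trivial, le_rfl⟩
  have hg₀ : -g p₀ = f p₀ := by linarith
  have hu₁ := hB' p₀
  rw [hg₀] at hu₁
  have hc : c < 0 := by
    have := hA' p₀ (f p₀ + 1) (by linarith)
    linarith
  have hA'' : ∀ p, ψ p + f p * c ≤ u := fun p => by
    by_contra! hlt
    have h1 := hA' p (f p + (ψ p + f p * c - u) / -c)
      (by linarith [div_pos (sub_pos.2 hlt) (neg_pos.2 hc)])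
    have h2 : (ψ p + f p * c - u) / -c * -c = ψ p + f p * c - u :=
      div_mul_cancel₀ _ (neg_pos.2 hc).ne'
    linarith
  refine ⟨(-c)⁻¹ • (InnerProductSpace.toDual ℝ E).symm ψ, ?_⟩
  have hw : ∀ p, inner ℝ p ((-c)⁻¹ • (InnerProductSpace.toDual ℝ E).symm ψ) = ψ p / -c := by
    intro p
    rw [inner_smul_right, real_inner_comm, InnerProductSpace.toDual_symm_apply]
    field_simp
  have hc' : 0 < -c := by linarith
  refine ⟨fun p => ?_, fun p => ?_⟩
  · have h1 := hA'' p
    rw [hw, map_sub, ← le_sub_iff_add_le', div_le_iff₀ hc']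
    linarith
  · have h1 := hB' p
    have h2 := hA'' p₀
    rw [hw, map_sub, sub_le_iff_le_add, ← sub_le_iff_le_add', le_div_iff₀ hc']
    have : g p₀ = - f p₀ := by linarith
    rw [this]
    linarith

/-- A subgradient of `l • f` is `l` times a subgradient of `f`, if `l ≠ 0`; otherwise it
vanishes. -/
lemma exists_smul_eq_of_subgradient {f : E → ℝ} {l : ℝ} (hl : 0 ≤ l) {p₀ w : E}
    (hw : ∀ p, l * f p₀ + inner ℝ (p - p₀) w ≤ l * f p) :
    ∃ q, l • q = w ∧ (l = 0 ∧ q = 0 ∨ ∀ p, f p₀ + inner ℝ (p - p₀) q ≤ f p) := by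
  rcases hl.eq_or_lt with rfl | hl
  · refine ⟨0, ?_, Or.inl ⟨rfl, rfl⟩⟩
    have := hw (p₀ + w)
    simp only [add_sub_cancel_left, zero_mul, zero_add] at this
    rw [smul_zero, eq_comm, ← inner_self_eq_zero (𝕜 := ℝ)]
    exact le_antisymm this real_inner_self_nonneg
  · refine ⟨l⁻¹ • w, smul_inv_smul₀ hl.ne' w, Or.inr fun p => ?_⟩
    rw [inner_smul_right]
    have := hw p
    have h2 : l * (l⁻¹ * inner ℝ (p - p₀) w) = inner ℝ (p - p₀) w := mul_inv_cancel_left₀ hl.ne' _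
    refine le_of_mul_le_mul_left ?_ hl
    linarith

/-- A subgradient `v` of `max f g` at `p₀` is a convex combination of subgradients of `f` and
`g`, with weights that charge only functions that realize the maximum. -/
lemma exists_split_subgradient [CompleteSpace E] {f g : E → ℝ} (hf : ConvexOn ℝ Set.univ f)
    (hg : ConvexOn ℝ Set.univ g) (hfc : Continuous f) {p₀ v : E}
    (hv : ∀ p, inner ℝ p v - max (f p) (g p) ≤ inner ℝ p₀ v - max (f p₀) (g p₀)) :
    ∃ (l : ℝ) (q₁ q₂ : E), 0 ≤ l ∧ l ≤ 1 ∧ l • q₁ + (1 - l) • q₂ = v ∧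
      (l = 0 ∧ q₁ = 0 ∨ ∀ p, f p₀ + inner ℝ (p - p₀) q₁ ≤ f p) ∧
      (1 - l = 0 ∧ q₂ = 0 ∨ ∀ p, g p₀ + inner ℝ (p - p₀) q₂ ≤ g p) ∧
      max (f p₀) (g p₀) ≤ l * f p₀ + (1 - l) * g p₀ := by
  set m : ℝ := inner ℝ p₀ v - max (f p₀) (g p₀)
  have hlin : ConvexOn ℝ Set.univ fun p : E => m - inner ℝ p v := by
    refine ⟨convex_univ, fun p _ q _ a b _ _ hab => le_of_eq ?_⟩
    simp only [inner_add_left, inner_smul_left, smul_eq_mul, RCLike.conj_to_real]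
    linear_combination -m * hab
  obtain ⟨l, hl0, hl1, hl⟩ := exists_convexCombination_nonneg (hf.add hlin) (hg.add hlin)
    fun p => by
      have := hv p
      simp only [Pi.add_apply]
      rw [max_add_add_right]
      linarith
  simp only [Pi.add_apply] at hl
  have h1 : max (f p₀) (g p₀) ≤ l * f p₀ + (1 - l) * g p₀ := by
    have := hl p₀
    simp only [m] at this
    linarith
  have h2 : l * f p₀ + (1 - l) * g p₀ ≤ max (f p₀) (g p₀) := by
    nlinarith [le_max_left (f p₀) (g p₀), le_max_right (f p₀) (g p₀)]
  obtain ⟨w, hw1, hw2⟩ := exists_affine_between (p₀ := p₀) (hf.smul hl0)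
    ((hg.smul (sub_nonneg.2 hl1)).add hlin) (hfc.const_smul l)
    (fun p => by
      have := hl p
      simp only [Pi.add_apply, smul_eq_mul]
      linarith)
    (by simp only [Pi.add_apply, smul_eq_mul, m]; linarith)
  simp only [Pi.add_apply, smul_eq_mul] at hw1 hw2
  obtain ⟨q₁, hq₁, hq₁'⟩ := exists_smul_eq_of_subgradient hl0 hw1
  obtain ⟨q₂, hq₂, hq₂'⟩ := exists_smul_eq_of_subgradient (f := g) (w := v - w) (p₀ := p₀)
    (sub_nonneg.2 hl1) fun p => by
      have := hw2 p
      have h3 : inner ℝ (p - p₀) v = inner ℝ p v - inner ℝ p₀ v := inner_sub_left _ _ _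
      rw [inner_sub_right]
      linarith
  exact ⟨l, q₁, q₂, hl0, hl1, by rw [hq₁, hq₂]; abel, hq₁', hq₂', h1⟩

end Convex

section Splitting

/-- The Legendre transform at a subgradient. -/
lemma lagrangian_le_of_subgradient {N : ℕ} {M : Type} {H : M → Euc N → ℝ} {x : M} {p₀ q : Euc N}
    (h : ∀ p, H x p₀ + inner ℝ (p - p₀) q ≤ H x p) : lagrangian H x q ≤ inner ℝ p₀ q - H x p₀ := by
  refine ciSup_le fun p => ?_
  have := h p
  rw [inner_sub_left] at this
  linarith

variable {N : ℕ} {M : Type} [SeminormedAddCommGroup M] {H H₁ H₂ : M → Euc N → ℝ}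

/-- Subgradients at bounded momenta are bounded, uniformly for `x` in a compact set. -/
lemma IsConvexHamiltonian.exists_subgradient_bound (hH : IsConvexHamiltonian H) {X : Set M}
    (hX : IsCompact X) (P : ℝ) :
    ∃ Q : ℝ, 0 ≤ Q ∧ ∀ x ∈ X, ∀ p₀ q, ‖p₀‖ ≤ P → (∀ p, H x p₀ + inner ℝ (p - p₀) q ≤ H x p) →
      ‖q‖ ≤ Q := by
  obtain ⟨K, hK0, hK⟩ := hH.exists_abs_le hX (P + 1)
  refine ⟨2 * K, by positivity, fun x hx p₀ q hp₀ hq => ?_⟩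
  rcases eq_or_ne q 0 with rfl | hq0
  · simpa using hK0
  have hq1 : ‖‖q‖⁻¹ • q‖ = 1 := norm_smul_inv_norm hq0
  have h1 := hq (p₀ + ‖q‖⁻¹ • q)
  have h2 := (abs_le.1 (hK x hx p₀ (by linarith))).1
  have h3 := (abs_le.1 (hK x hx (p₀ + ‖q‖⁻¹ • q) ((norm_add_le _ _).trans (by linarith)))).2
  rw [add_sub_cancel_left, real_inner_smul_left, real_inner_self_eq_norm_mul_norm,
    inv_mul_cancel_left₀ (norm_ne_zero_iff.2 hq0)] at h1
  linarith

/-- The Lagrangian of `max H₁ H₂` is realized by convex combinations of the Lagrangians of `H₁` and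
`H₂`, with velocities that are bounded on bounded sets. -/
lemma IsConvexHamiltonian.exists_split_velocity (h₁ : IsConvexHamiltonian H₁)
    (h₂ : IsConvexHamiltonian H₂) {X : Set M} (hX : IsCompact X) (R : ℝ) :
    ∃ Q : ℝ, 0 ≤ Q ∧ ∀ x ∈ X, ∀ v, ‖v‖ ≤ R → ∃ (l : ℝ) (q₁ q₂ : Euc N), 0 ≤ l ∧ l ≤ 1 ∧
      ‖q₁‖ ≤ Q ∧ ‖q₂‖ ≤ Q ∧ l • q₁ + (1 - l) • q₂ = v ∧
      l * lagrangian H₁ x q₁ + (1 - l) * lagrangian H₂ x q₂ ≤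
        lagrangian (fun x p => max (H₁ x p) (H₂ x p)) x v := by
  obtain ⟨P, -, hP⟩ := (h₁.sup h₂).exists_norm_le_of_lagrangian_eq R
  obtain ⟨Q₁, hQ₁, hQ₁'⟩ := h₁.exists_subgradient_bound hX P
  obtain ⟨Q₂, hQ₂, hQ₂'⟩ := h₂.exists_subgradient_bound hX P
  refine ⟨max Q₁ Q₂, le_max_of_le_left hQ₁, fun x hx v hv => ?_⟩
  obtain ⟨p₀, hp₀⟩ := (h₁.sup h₂).exists_lagrangian_eq x v
  have hpP := hP x v hv p₀ hp₀
  obtain ⟨l, q₁, q₂, hl0, hl1, hlv, hq₁, hq₂, hmax⟩ := exists_split_subgradient (h₁.convex x)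
    (h₂.convex x) (h₁.continuous_right x) (p₀ := p₀) (v := v)
    fun p => ((h₁.sup h₂).le_lagrangian x p v).trans hp₀.le
  refine ⟨l, q₁, q₂, hl0, hl1, ?_, ?_, hlv, ?_⟩
  · rcases hq₁ with ⟨-, rfl⟩ | hq₁
    · simp [hQ₁]
    · exact (hQ₁' x hx p₀ q₁ hpP hq₁).trans (le_max_left _ _)
  · rcases hq₂ with ⟨-, rfl⟩ | hq₂
    · simp [hQ₂]
    · exact (hQ₂' x hx p₀ q₂ hpP hq₂).trans (le_max_right _ _)
  · have e₁ : l * lagrangian H₁ x q₁ ≤ l * (inner ℝ p₀ q₁ - H₁ x p₀) := by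
      rcases hq₁ with ⟨rfl, -⟩ | hq₁
      · simp
      · exact mul_le_mul_of_nonneg_left (lagrangian_le_of_subgradient hq₁) hl0
    have e₂ : (1 - l) * lagrangian H₂ x q₂ ≤ (1 - l) * (inner ℝ p₀ q₂ - H₂ x p₀) := by
      rcases hq₂ with ⟨h0, -⟩ | hq₂
      · simp [h0]
      · exact mul_le_mul_of_nonneg_left (lagrangian_le_of_subgradient hq₂) (by linarith)
    have e₃ : inner ℝ p₀ v = l * inner ℝ p₀ q₁ + (1 - l) * inner ℝ p₀ q₂ := by
      rw [← hlv, inner_add_right, inner_smul_right, inner_smul_right]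
    rw [hp₀, e₃]
    linarith

end Splitting

end HJ

/-! ### Absolutely continuous curves -/

namespace AbsolutelyContinuousOnInterval

/-- Composition with a monotone `1`-Lipschitz change of time. -/
lemma comp_monotone {X : Type*} [PseudoMetricSpace X] {f : ℝ → X} {g : ℝ → ℝ} {a b c d : ℝ}
    (hf : AbsolutelyContinuousOnInterval f a b) (hg : Monotone g)
    (hg₁ : ∀ x y, dist (g x) (g y) ≤ dist x y)
    (hmaps : Set.MapsTo g (Set.uIcc c d) (Set.uIcc a b)) :
    AbsolutelyContinuousOnInterval (fun s => f (g s)) c d := by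
  rw [absolutelyContinuousOnInterval_iff] at hf ⊢
  intro ε hε
  obtain ⟨δ, hδ, h⟩ := hf ε hε
  refine ⟨δ, hδ, fun E hE hlen => ?_⟩
  refine h (E.1, fun i => (g (E.2 i).1, g (E.2 i).2)) ⟨fun i hi => ?_, fun i hi j hj hij => ?_⟩
    ((Finset.sum_le_sum fun i _ => hg₁ _ _).trans_lt hlen)
  · exact ⟨hmaps (hE.1 i hi).1, hmaps (hE.1 i hi).2⟩
  · have := hE.2 hi hj hij
    simp only [Function.onFun, Set.uIoc, Set.Ioc_disjoint_Ioc] at this ⊢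
    simpa [hg.map_min, hg.map_max] using hg this

/-- Time shifts of curves. -/
lemma comp_add_const {X : Type*} [PseudoMetricSpace X] {η : ℝ → X} {a b : ℝ}
    (hη : AbsolutelyContinuousOnInterval η a b) (c : ℝ) :
    AbsolutelyContinuousOnInterval (fun r => η (r + c)) (a - c) (b - c) :=
  hη.comp_monotone (fun _ _ h => by simpa using h) (fun _ _ => by simp) fun r hr => by
    simpa [Set.mem_uIcc, sub_le_iff_le_add, le_sub_iff_add_le] using hr

/-- Composition with a Lipschitz map. -/
lemma lipschitz_comp {X Y : Type*} [PseudoMetricSpace X] [PseudoMetricSpace Y] {f : ℝ → X}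
    {φ : X → Y} {K : NNReal} {a b : ℝ} (hφ : LipschitzWith K φ)
    (hf : AbsolutelyContinuousOnInterval f a b) :
    AbsolutelyContinuousOnInterval (fun s => φ (f s)) a b := by
  have h := Filter.Tendsto.const_mul (K : ℝ) (show Tendsto _ _ _ from hf)
  rw [mul_zero] at h
  refine squeeze_zero (fun E => Finset.sum_nonneg fun i _ => dist_nonneg) (fun E => ?_) h
  rw [Finset.mul_sum]
  exact Finset.sum_le_sum fun i _ => hφ.dist_le_mul _ _

lemma inner_left {E : Type*} [NormedAddCommGroup E] [InnerProductSpace ℝ E] {f : ℝ → E} {a b : ℝ}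
    (hf : AbsolutelyContinuousOnInterval f a b) (p : E) :
    AbsolutelyContinuousOnInterval (fun s => inner ℝ p (f s)) a b :=
  hf.lipschitz_comp (innerSL ℝ p).lipschitz

lemma ae_differentiableAt_euclidean {N : ℕ} {f : ℝ → HJ.Euc N} {a b : ℝ}
    (hf : AbsolutelyContinuousOnInterval f a b) :
    ∀ᵐ s, s ∈ Set.uIcc a b → DifferentiableAt ℝ f s := by
  have h : ∀ i : Fin N, ∀ᵐ s, s ∈ Set.uIcc a b → DifferentiableAt ℝ (fun r => f r i) s := fun i =>
    by simpa [EuclideanSpace.inner_single_left] using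
      (hf.inner_left (EuclideanSpace.single i (1 : ℝ))).ae_differentiableAt
  filter_upwards [ae_all_iff.2 h] with s hs hmem
  exact differentiableAt_euclidean.2 fun i => hs i hmem

end AbsolutelyContinuousOnInterval

namespace HJ

/-! ### The action of a curve -/

section Cost

variable {N : ℕ} {M : Type} [SeminormedAddCommGroup M] {H : M → Euc N → ℝ} {π : Euc N → M}
  {η : ℝ → Euc N} {a b : ℝ}

/-- The common features of the identity of `ℝ^N` and of the projection onto the torus. -/
structure IsProjection (π : Euc N → M) : Prop where
  map_add : ∀ x y, π (x + y) = π x + π y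
  norm_le : ∀ x, ‖π x‖ ≤ ‖x‖
  surjective : Function.Surjective π

lemma IsProjection.map_sub (hπ : IsProjection π) (x y : Euc N) : π (x - y) = π x - π y := by
  rw [eq_sub_iff_add_eq, ← hπ.map_add, sub_add_cancel]

lemma IsProjection.continuous (hπ : IsProjection π) : Continuous π := by
  have : LipschitzWith 1 π := LipschitzWith.of_dist_le_mul fun x y => by
    rw [dist_eq_norm, dist_eq_norm, ← hπ.map_sub]
    simpa using hπ.norm_le (x - y)
  exact this.continuous

/-- The lift of a convex Hamiltonian to `ℝ^N`. -/
lemma IsConvexHamiltonian.lift (hH : IsConvexHamiltonian H) (hπ : Continuous π) :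
    IsConvexHamiltonian fun x p => H (π x) p where
  continuous := hH.continuous.comp (hπ.prodMap continuous_id)
  convex x := hH.convex (π x)
  growth := by
    obtain ⟨α, β, hα, hβ, h⟩ := hH.growth
    exact ⟨α, β, hα, hβ, fun x p => h (π x) p⟩

/-- The integrand `L(γ, γ')` of the action of the curve `γ = π ∘ η`. -/
noncomputable abbrev runningCost (H : M → Euc N → ℝ) (π : Euc N → M) (η : ℝ → Euc N) (s : ℝ) : ℝ :=
  lagrangian H (π (η s)) (deriv η s)

lemma IsConvexHamiltonian.aestronglyMeasurable_runningCost (hH : IsConvexHamiltonian H)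
    (hπ : Continuous π) (hη : ContinuousOn η (Set.uIcc a b)) :
    AEStronglyMeasurable (runningCost H π η) (volume.restrict (Set.uIoc a b)) := by
  have hL := (hH.lift hπ).lowerSemicontinuous_lagrangian.measurable
  have hη' : AEMeasurable η (volume.restrict (Set.uIoc a b)) :=
    ((hη.mono Set.uIoc_subset_uIcc).aestronglyMeasurable measurableSet_uIoc).aemeasurable
  exact (hL.comp_aemeasurable (hη'.prodMk (measurable_deriv η).aemeasurable)).aestronglyMeasurable

/-- A running cost that is bounded above by an integrable function is integrable, since it is
bounded below. -/
lemma IsConvexHamiltonian.intervalIntegrable_runningCost (hH : IsConvexHamiltonian H)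
    (hπ : Continuous π) (hη : ContinuousOn η (Set.uIcc a b)) {g : ℝ → ℝ}
    (hg : IntervalIntegrable g volume a b) (hle : ∀ s ∈ Set.uIoc a b, runningCost H π η s ≤ g s) :
    IntervalIntegrable (runningCost H π η) volume a b := by
  obtain ⟨C, hC⟩ := hH.exists_neg_le_lagrangian
  have hg' : IntervalIntegrable (fun s => |g s| + |C|) volume a b :=
    hg.abs.add intervalIntegrable_const
  refine hg'.mono_fun (hH.aestronglyMeasurable_runningCost hπ hη) ?_
  filter_upwards [ae_restrict_mem measurableSet_uIoc] with s hs
  have h1 := hle s hs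
  have h2 := hC (π (η s)) (deriv η s)
  rw [Real.norm_eq_abs, Real.norm_eq_abs, abs_of_nonneg (by positivity : 0 ≤ |g s| + |C|), abs_le]
  constructor
  · linarith [le_abs_self C, abs_nonneg (g s)]
  · linarith [le_abs_self (g s), abs_nonneg C]

/-- The action of a curve is bounded below by testing the supremum in the Lagrangian with a
constant momentum. -/
lemma IsConvexHamiltonian.inner_sub_le_integral (hH : IsConvexHamiltonian H) (hab : a ≤ b)
    (hη : AbsolutelyContinuousOnInterval η a b)
    (hi : IntervalIntegrable (runningCost H π η) volume a b) {p : Euc N} {h : ℝ}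
    (hh : ∀ s ∈ Set.Icc a b, H (π (η s)) p ≤ h) :
    inner ℝ p (η b - η a) - h * (b - a) ≤ ∫ s in a..b, runningCost H π η s := by
  have hp := hη.inner_left p
  have h1 : inner ℝ p (η b - η a) - h * (b - a) =
      ∫ s in a..b, (deriv (fun r => inner ℝ p (η r)) s - h) := by
    rw [intervalIntegral.integral_sub hp.intervalIntegrable_deriv intervalIntegrable_const,
      hp.integral_deriv_eq_sub, inner_sub_right, intervalIntegral.integral_const, smul_eq_mul]
    ring
  rw [h1]
  refine intervalIntegral.integral_mono_ae_restrict hab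
    (hp.intervalIntegrable_deriv.sub intervalIntegrable_const) hi ?_
  filter_upwards [ae_restrict_mem measurableSet_Icc,
    ae_restrict_of_ae hη.ae_differentiableAt_euclidean] with s hs hd
  have hd' := (hd (Set.Icc_subset_uIcc hs)).hasDerivAt
  have h2 : deriv (fun r => inner ℝ p (η r)) s = inner ℝ p (deriv η s) := by
    simpa using ((hasDerivAt_const s p).inner ℝ hd').deriv
  simp only [h2]
  have h3 := hH.le_lagrangian (π (η s)) p (deriv η s)
  linarith [hh s hs]

/-- The action controls any multiple of the displacement. -/
lemma IsConvexHamiltonian.exists_mul_norm_sub_le_integral (hH : IsConvexHamiltonian H)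
    (π : Euc N → M) {A : ℝ} (hA : 0 ≤ A) :
    ∃ C : ℝ, ∀ (η : ℝ → Euc N) (a b : ℝ), a ≤ b → AbsolutelyContinuousOnInterval η a b →
      IntervalIntegrable (runningCost H π η) volume a b →
      A * ‖η b - η a‖ - C * (b - a) ≤ ∫ s in a..b, runningCost H π η s := by
  obtain ⟨α, β, -, -, hαβ⟩ := hH.growth
  refine ⟨max (β A) (β 0), fun η a b hab hη hi => ?_⟩
  rcases eq_or_ne (η b - η a) 0 with h0 | h0
  · have := hH.inner_sub_le_integral hab hη hi (p := 0) (h := max (β A) (β 0)) fun s _ => by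
      have := (hαβ (π (η s)) 0).2
      rw [norm_zero] at this
      exact this.trans (le_max_right _ _)
    simpa [h0] using this
  · have hn : ‖A • ‖η b - η a‖⁻¹ • (η b - η a)‖ = A := by
      rw [norm_smul, norm_smul, norm_inv, norm_norm, inv_mul_cancel₀ (norm_ne_zero_iff.2 h0),
        Real.norm_of_nonneg hA, mul_one]
    have := hH.inner_sub_le_integral hab hη hi (p := A • ‖η b - η a‖⁻¹ • (η b - η a))
      (h := max (β A) (β 0)) fun s _ => by
        have := (hαβ (π (η s)) (A • ‖η b - η a‖⁻¹ • (η b - η a))).2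
        rw [hn] at this
        exact this.trans (le_max_left _ _)
    rwa [real_inner_smul_left, real_inner_smul_left, real_inner_self_eq_norm_mul_norm,
      inv_mul_cancel_left₀ (norm_ne_zero_iff.2 h0)] at this

end Cost

/-! ### The Lax-Oleinik semigroup -/

section Semigroup

variable {N : ℕ} {M : Type} {H G : M → Euc N → ℝ} {π : Euc N → M}
  {u v : M → EReal} {x : M} {s t : ℝ}

lemma laxOleinik_le {η : ℝ → Euc N} (hη : AbsolutelyContinuousOnInterval η (-t) 0)
    (h0 : π (η 0) = x) (hi : IntervalIntegrable (runningCost H π η) volume (-t) 0) :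
    laxOleinik π H t u x ≤
      u (π (η (-t))) + ((∫ r in (-t)..0, runningCost H π η r : ℝ) : EReal) := by
  refine (iInf₂_le η ⟨hη, h0⟩).trans ?_
  rw [action, if_pos hi]

/-- Only curves with finite action matter for a lower bound. -/
lemma le_laxOleinik (hu : ∀ y, u y ≠ ⊥) {a : EReal}
    (h : ∀ η : ℝ → Euc N, AbsolutelyContinuousOnInterval η (-t) 0 → π (η 0) = x →
      IntervalIntegrable (runningCost H π η) volume (-t) 0 →
      a ≤ u (π (η (-t))) + ((∫ r in (-t)..0, runningCost H π η r : ℝ) : EReal)) :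
    a ≤ laxOleinik π H t u x := by
  refine le_iInf₂ fun η hη => ?_
  rw [action]
  split_ifs with hi
  · exact h η hη.1 hη.2 hi
  · rw [EReal.add_top_of_ne_bot (hu _)]
    exact le_top

lemma laxOleinik_mono (h : ∀ y, u y ≤ v y) (x : M) :
    laxOleinik π H t u x ≤ laxOleinik π H t v x :=
  iInf₂_mono fun η _ => by gcongr; exact h _

lemma runningCost_comp_add_const {η : ℝ → Euc N} (c : ℝ) :
    runningCost H π (fun r => η (r + c)) = fun r => runningCost H π η (r + c) := by
  funext r
  simp only [runningCost, deriv_comp_add_const]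

/-- The Lax-Oleinik operator commutes with infima. -/
lemma laxOleinik_iInf {ι : Sort*} {f : ι → M → EReal} (hf : ∀ y, ⨅ i, f i y ≠ ⊥) (x : M) :
    laxOleinik π H t (fun y => ⨅ i, f i y) x = ⨅ i, laxOleinik π H t (f i) x := by
  refine le_antisymm (le_iInf fun i => laxOleinik_mono (fun y => iInf_le _ i) x) ?_
  refine le_laxOleinik hf fun η hη h0 hi => ?_
  rw [← EReal.sub_le_iff_le_add (.inl (EReal.coe_ne_bot _)) (.inl (EReal.coe_ne_top _))]
  refine le_iInf fun i => ?_
  rw [EReal.sub_le_iff_le_add (.inl (EReal.coe_ne_bot _)) (.inl (EReal.coe_ne_top _))]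
  exact (iInf_le _ i).trans (laxOleinik_le hη h0 hi)

variable [SeminormedAddCommGroup M]

lemma Admissible.ne_bot (hu : Admissible u) (x : M) : u x ≠ ⊥ := by
  obtain ⟨a, b, h⟩ := hu
  exact ne_bot_of_le_ne_bot (EReal.coe_ne_bot _) (h x)

lemma laxOleinik_zero (hπ : IsProjection π) (u : M → EReal) : laxOleinik π H 0 u = u := by
  funext x
  have hact : ∀ η, action π H 0 η = 0 := fun η => by simp [action]
  refine le_antisymm ?_ (le_iInf₂ fun η hη => ?_)
  · obtain ⟨y, rfl⟩ := hπ.surjective x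
    refine (iInf₂_le (fun _ => y)
      ⟨(LipschitzWith.const y).lipschitzOnWith.absolutelyContinuousOnInterval, rfl⟩).trans ?_
    rw [hact, add_zero]
  · rw [hact, add_zero, neg_zero, hη.2]

/-- The Lax-Oleinik operator preserves lower bounds of the form `a‖x‖ + b`, up to a change of `b`
that is locally uniform in time. -/
lemma IsConvexHamiltonian.exists_le_laxOleinik (hH : IsConvexHamiltonian H) (hπ : IsProjection π)
    (a : ℝ) : ∃ C : ℝ, ∀ (u : M → EReal) (b t : ℝ), 0 ≤ t →
      (∀ x, ((a * ‖x‖ + b : ℝ) : EReal) ≤ u x) →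
      ∀ x, ((a * ‖x‖ + (b - C * t) : ℝ) : EReal) ≤ laxOleinik π H t u x := by
  obtain ⟨C, hC⟩ := hH.exists_mul_norm_sub_le_integral π (abs_nonneg a)
  refine ⟨C, fun u b t ht hu x => le_laxOleinik
    (fun y => ne_bot_of_le_ne_bot (EReal.coe_ne_bot _) (hu y)) fun η hη h0 hi => ?_⟩
  refine le_trans ?_ (add_le_add_left (hu _) _)
  rw [← EReal.coe_add, EReal.coe_le_coe_iff, ← h0]
  have h1 := hC η (-t) 0 (by linarith) hη hi
  have h2 : |‖π (η 0)‖ - ‖π (η (-t))‖| ≤ ‖η 0 - η (-t)‖ := by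
    refine (abs_norm_sub_norm_le _ _).trans ?_
    rw [← hπ.map_sub]
    exact hπ.norm_le _
  have h3 : a * (‖π (η 0)‖ - ‖π (η (-t))‖) ≤ |a| * ‖η 0 - η (-t)‖ := by
    refine (le_abs_self _).trans ?_
    rw [abs_mul]
    gcongr
  linarith

lemma Admissible.laxOleinik (hu : Admissible u) (hH : IsConvexHamiltonian H)
    (hπ : IsProjection π) (ht : 0 ≤ t) : Admissible (laxOleinik π H t u) := by
  obtain ⟨a, b, h⟩ := hu
  obtain ⟨C, hC⟩ := hH.exists_le_laxOleinik hπ a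
  exact ⟨a, b - C * t, hC u b t ht h⟩

/-- A larger Hamiltonian has smaller Lax-Oleinik operators. -/
lemma laxOleinik_anti (hH : IsConvexHamiltonian H) (hG : IsConvexHamiltonian G)
    (hπ : IsProjection π) (hle : ∀ x p, H x p ≤ G x p) (ht : 0 ≤ t) (hu : Admissible u) (x : M) :
    laxOleinik π G t u x ≤ laxOleinik π H t u x := by
  refine le_laxOleinik hu.ne_bot fun η hη h0 hi => ?_
  have hi' := hG.intervalIntegrable_runningCost hπ.continuous hη.continuousOn hi
    fun s _ => lagrangian_anti hH hle _ _
  refine (laxOleinik_le hη h0 hi').trans ?_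
  gcongr
  exact intervalIntegral.integral_mono_on (by linarith) hi' hi
    fun s _ => lagrangian_anti hH hle _ _

/-- Restriction of curves: half of the semigroup property. -/
lemma laxOleinik_laxOleinik_le (hs : 0 ≤ s) (ht : 0 ≤ t) (hu : Admissible u) (x : M) :
    laxOleinik π H t (laxOleinik π H s u) x ≤ laxOleinik π H (s + t) u x := by
  refine le_laxOleinik hu.ne_bot fun η hη h0 hi => ?_
  have hsub₁ : Set.uIcc (-(s + t)) (-t) ⊆ Set.uIcc (-(s + t)) 0 := by
    rw [Set.uIcc_of_le (by linarith), Set.uIcc_of_le (by linarith)]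
    exact Set.Icc_subset_Icc le_rfl (by linarith)
  have hsub₂ : Set.uIcc (-t) 0 ⊆ Set.uIcc (-(s + t)) 0 := by
    rw [Set.uIcc_of_le (by linarith), Set.uIcc_of_le (by linarith)]
    exact Set.Icc_subset_Icc (by linarith) le_rfl
  have hi₁ := hi.mono_set hsub₁
  have hi₂ := hi.mono_set hsub₂
  have hη₁ := (hη.mono hsub₁).comp_add_const (-t)
  have e₁ : -(s + t) - -t = -s := by ring
  have e₂ : -s + -t = -(s + t) := by ring
  rw [e₁, sub_self] at hη₁
  have hi₁' : IntervalIntegrable (runningCost H π fun r => η (r + -t)) volume (-s) 0 := by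
    rw [runningCost_comp_add_const]
    simpa [e₁] using hi₁.comp_add_right (-t)
  have h₂ := laxOleinik_le (u := laxOleinik π H s u) (hη.mono hsub₂) h0 hi₂
  have h₁ := laxOleinik_le (u := u) (x := π (η (-t))) hη₁ (by simp) hi₁'
  refine h₂.trans ((add_le_add_left h₁ _).trans ?_)
  rw [runningCost_comp_add_const, intervalIntegral.integral_comp_add_right, e₂, zero_add,
    add_assoc, ← EReal.coe_add, intervalIntegral.integral_add_adjacent_intervals hi₁ hi₂]

/-- Concatenation of curves: the other half of the semigroup property. -/
lemma laxOleinik_add_le (hπ : IsProjection π) (hH : IsConvexHamiltonian H)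
    (hs : 0 ≤ s) (ht : 0 ≤ t) (hu : Admissible u) (x : M) :
    laxOleinik π H (s + t) u x ≤ laxOleinik π H t (laxOleinik π H s u) x := by
  refine le_laxOleinik (hu.laxOleinik hH hπ hs).ne_bot fun η₂ hη₂ h0 hi₂ => ?_
  rw [← EReal.sub_le_iff_le_add (.inl (EReal.coe_ne_bot _)) (.inl (EReal.coe_ne_top _))]
  refine le_laxOleinik hu.ne_bot fun η₁ hη₁ h1 hi₁ => ?_
  rw [EReal.sub_le_iff_le_add (.inl (EReal.coe_ne_bot _)) (.inl (EReal.coe_ne_top _))]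
  -- The lift `η₁` is first translated by `η₂ (-t) - η₁ 0`, which `π` maps to `0`, so that the two
  -- curves fit together.
  set ζ : ℝ → Euc N := fun r => η₁ (min (r + t) 0) - η₁ 0 + η₂ (max r (-t)) with hζ
  have hζac : AbsolutelyContinuousOnInterval ζ (-(s + t)) 0 := by
    refine AbsolutelyContinuousOnInterval.fun_add (AbsolutelyContinuousOnInterval.fun_sub
      (hη₁.comp_monotone (fun a b h => ?_) (fun a b => ?_) fun r hr => ?_)
      (LipschitzWith.const (η₁ 0)).lipschitzOnWith.absolutelyContinuousOnInterval)
      (hη₂.comp_monotone (fun a b h => ?_) (fun a b => ?_) fun r hr => ?_)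
    · gcongr
    · simpa [Real.dist_eq] using abs_min_sub_min_le_max (a + t) 0 (b + t) 0
    · rw [Set.uIcc_of_le (by linarith)] at hr ⊢
      exact ⟨le_min (by linarith [hr.1]) (by linarith), min_le_right _ _⟩
    · gcongr
    · simpa [Real.dist_eq] using abs_max_sub_max_le_max a (-t) b (-t)
    · rw [Set.uIcc_of_le (by linarith)] at hr ⊢
      exact ⟨le_max_right _ _, max_le hr.2 (by linarith)⟩
  have hζ₁ : ∀ r < -t, ζ r = η₁ (r + t) + (η₂ (-t) - η₁ 0) := fun r hr => by
    simp only [hζ]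
    rw [min_eq_left (by linarith), max_eq_right hr.le]
    abel
  have hζ₂ : ∀ r, -t ≤ r → ζ r = η₂ r := fun r hr => by
    simp only [hζ]
    rw [min_eq_right (by linarith), max_eq_left hr, sub_self, zero_add]
  have hz : π (η₂ (-t) - η₁ 0) = 0 := by rw [hπ.map_sub, h1, sub_self]
  have hc₁ : Set.EqOn (runningCost H π fun r => η₁ (r + t)) (runningCost H π ζ)
      (Set.uIoo (-(s + t)) (-t)) := fun r hr => by
    rw [Set.uIoo_of_le (by linarith)] at hr
    have hev : ζ =ᶠ[𝓝 r] fun r => η₁ (r + t) + (η₂ (-t) - η₁ 0) := by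
      filter_upwards [Iio_mem_nhds hr.2] with r' hr' using hζ₁ r' hr'
    simp only [runningCost]
    rw [hev.deriv_eq, deriv_add_const, hζ₁ r hr.2, hπ.map_add, hz, add_zero]
  have hc₂ : Set.EqOn (runningCost H π η₂) (runningCost H π ζ) (Set.uIoo (-t) 0) := fun r hr => by
    rw [Set.uIoo_of_le (by linarith)] at hr
    have hev : ζ =ᶠ[𝓝 r] η₂ := by
      filter_upwards [Ioi_mem_nhds hr.1] with r' hr' using hζ₂ r' (le_of_lt hr')
    simp only [runningCost]
    rw [hev.deriv_eq, hζ₂ r hr.1.le]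
  have e₁ : -s - t = -(s + t) := by ring
  have e₂ : -(s + t) + t = -s := by ring
  have hi₁' : IntervalIntegrable (runningCost H π ζ) volume (-(s + t)) (-t) := by
    refine IntervalIntegrable.congr_uIoo ?_ hc₁
    rw [runningCost_comp_add_const]
    simpa [e₁] using hi₁.comp_add_right t
  have hi₂' : IntervalIntegrable (runningCost H π ζ) volume (-t) 0 := hi₂.congr_uIoo hc₂
  refine (laxOleinik_le hζac (by rw [hζ₂ 0 (by linarith), h0]) (hi₁'.trans hi₂')).trans ?_
  have hend : π (ζ (-(s + t))) = π (η₁ (-s)) := by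
    have : ζ (-(s + t)) = η₁ (-s) + (η₂ (-t) - η₁ 0) := by
      simp only [hζ]
      rw [e₂, min_eq_left (by linarith), max_eq_right (by linarith)]
      abel
    rw [this, hπ.map_add, hz, add_zero]
  rw [hend, ← intervalIntegral.integral_add_adjacent_intervals hi₁' hi₂',
    ← intervalIntegral.integral_congr_uIoo hc₁, ← intervalIntegral.integral_congr_uIoo hc₂,
    runningCost_comp_add_const, intervalIntegral.integral_comp_add_right, e₂, neg_add_cancel,
    EReal.coe_add, add_assoc]

/-- The semigroup property. -/
lemma laxOleinik_laxOleinik (hπ : IsProjection π) (hH : IsConvexHamiltonian H)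
    (hs : 0 ≤ s) (ht : 0 ≤ t) (hu : Admissible u) :
    laxOleinik π H t (laxOleinik π H s u) = laxOleinik π H (s + t) u :=
  funext fun x => le_antisymm (laxOleinik_laxOleinik_le hs ht hu x)
    (laxOleinik_add_le hπ hH hs ht hu x)

/-- The commutation of two semigroups, including the time `0`. -/
lemma Commute.laxOleinik_comm (hHG : Commute π H G) (hπ : IsProjection π) (hs : 0 ≤ s)
    (ht : 0 ≤ t) (hu : Admissible u) :
    laxOleinik π G s (laxOleinik π H t u) = laxOleinik π H t (laxOleinik π G s u) := by
  rcases hs.eq_or_lt with rfl | hs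
  · simp only [laxOleinik_zero hπ]
  rcases ht.eq_or_lt with rfl | ht
  · simp only [laxOleinik_zero hπ]
  exact funext fun x => hHG u hu s t hs ht x

/-- The cost of moving along a segment. -/
lemma laxOleinik_le_segment (hπ : IsProjection π) (hH : IsConvexHamiltonian H) (ht : 0 ≤ t)
    {y q : Euc N} {c : ℝ} (hc : ∀ r, 0 ≤ r → r ≤ t → lagrangian H (π (y + r • q)) q ≤ c) :
    laxOleinik π H t u (π (y + t • q)) ≤ u (π y) + ((t * c : ℝ) : EReal) := by
  set η : ℝ → Euc N := fun r => y + (r + t) • q with hη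
  have hd : ∀ r, deriv η r = q := fun r => by
    have : HasDerivAt η ((1 : ℝ) • q) r :=
      (((hasDerivAt_id r).add_const t).smul_const q).const_add y
    simpa using this.deriv
  have hac : AbsolutelyContinuousOnInterval η (-t) 0 :=
    ContDiffOn.absolutelyContinuousOnInterval (by fun_prop)
  have hle : ∀ r ∈ Set.Icc (-t) 0, runningCost H π η r ≤ c := fun r hr => by
    rw [runningCost, hd]
    exact hc (r + t) (by linarith [hr.1]) (by linarith [hr.2])
  have hi : IntervalIntegrable (runningCost H π η) volume (-t) 0 := by
    refine hH.intervalIntegrable_runningCost hπ.continuous hac.continuousOn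
      (g := fun _ => c) intervalIntegrable_const fun r hr => hle r ?_
    rw [Set.uIoc_of_le (by linarith)] at hr
    exact Set.Ioc_subset_Icc_self hr
  refine (laxOleinik_le hac (by simp [hη]) hi).trans ?_
  have h1 : η (-t) = y := by simp [hη]
  have h2 := intervalIntegral.integral_mono_on (by linarith) hi intervalIntegrable_const hle
  rw [intervalIntegral.integral_const, smul_eq_mul, zero_sub, neg_neg] at h2
  rw [h1]
  gcongr

end Semigroup

/-! ### Discretization of curves -/

section Discretization

variable {N : ℕ} {M : Type} [SeminormedAddCommGroup M] {H : M → Euc N → ℝ} {π : Euc N → M}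
  {η : ℝ → Euc N}

/-- Comparison of the action of a curve with that of a segment with the same endpoints, possibly
travelled in a different time `σ`. The momentum `p` dual to the velocity of the segment serves as
a test momentum, so that no bound on the speed of the curve is needed. -/
lemma IsConvexHamiltonian.mul_lagrangian_le_integral (hH : IsConvexHamiltonian H) {a b σ ω : ℝ}
    (hab : a ≤ b) (hη : AbsolutelyContinuousOnInterval η a b)
    (hi : IntervalIntegrable (runningCost H π η) volume a b) {v p : Euc N}
    (hv : η b - η a = σ • v) (hp : lagrangian H (π (η a)) v = inner ℝ p v - H (π (η a)) p)
    (hω : ∀ s ∈ Set.Icc a b, H (π (η s)) p ≤ H (π (η a)) p + ω) :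
    σ * lagrangian H (π (η a)) v ≤
      (∫ s in a..b, runningCost H π η s) + ω * (b - a) + (b - a - σ) * H (π (η a)) p := by
  have h := hH.inner_sub_le_integral hab hη hi hω
  rw [hv, real_inner_smul_right] at h
  rw [hp]
  linarith

/-- Bound for the loss `(h - σ) e` on an edge of energy `e`, where `h - σ = a - y`: an upper bound on
`e` is needed only if the edge is travelled in less time than `h`. -/
lemma sub_mul_le_of_imp {a y e K C : ℝ} (ha : 0 ≤ a) (hy : 0 ≤ y) (hK : 0 ≤ K) (hC : 0 ≤ C)
    (he : -C ≤ e) (h : y ≤ a → e ≤ K) : (a - y) * e ≤ a * K + C * y := by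
  by_cases hya : y ≤ a
  · have h1 : (a - y) * e ≤ (a - y) * K := mul_le_mul_of_nonneg_left (h hya) (by linarith)
    linarith [mul_nonneg hy hK, mul_nonneg hC hy]
  · have h1 : (y - a) * -C ≤ (y - a) * e := mul_le_mul_of_nonneg_left he (by linarith)
    linarith [mul_nonneg ha hC, mul_nonneg ha hK]

/-- An absolutely continuous curve with finite action is approximated by a polygon with the same
endpoints and the same total duration, with bounded speed (independently of the mesh `δ`), and
with an almost minimal action; here the Lagrangian is frozen at the initial vertex of each edge.

An edge with displacement `Δ` of the inscribed polygon with time step `h` is given the duration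
`(1 - θ) h + ‖Δ‖ / R`, where `θ` is such that the total duration is unchanged. -/
lemma IsConvexHamiltonian.exists_polygon (hH : IsConvexHamiltonian H) (hπ : Continuous π) {t : ℝ}
    (ht : 0 < t) (hη : AbsolutelyContinuousOnInterval η (-t) 0)
    (hi : IntervalIntegrable (runningCost H π η) volume (-t) 0) {ε : ℝ} (hε : 0 < ε) :
    ∃ R : ℝ, ∀ δ > 0, ∃ (n : ℕ) (x v : ℕ → Euc N) (σ : ℕ → ℝ), x 0 = η (-t) ∧ x n = η 0 ∧
      (∀ k < n, x k ∈ η '' Set.Icc (-t) 0 ∧ 0 ≤ σ k ∧ σ k < δ ∧ ‖v k‖ ≤ R ∧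
        x (k + 1) = x k + σ k • v k) ∧
      ∑ k ∈ Finset.range n, σ k = t ∧
      ∑ k ∈ Finset.range n, σ k * lagrangian H (π (x k)) (v k) ≤
        (∫ s in (-t)..0, runningCost H π η s) + ε := by
  have ht' : -t ≤ 0 := by linarith
  set I := ∫ s in (-t)..0, runningCost H π η s
  have hηc : ContinuousOn η (Set.Icc (-t) 0) := by simpa [Set.uIcc_of_le ht'] using hη.continuousOn
  have hγc : ContinuousOn (fun s => π (η s)) (Set.Icc (-t) 0) := hπ.comp_continuousOn hηc
  have hX := isCompact_Icc.image_of_continuousOn hγc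
  set X := (fun s => π (η s)) '' Set.Icc (-t) 0
  -- `V` bounds the length of all inscribed polygons.
  obtain ⟨C₁, hC₁⟩ := hH.exists_mul_norm_sub_le_integral π zero_le_one
  set V := I + C₁ * t
  have hV0 : 0 ≤ V := by
    have := hC₁ η (-t) 0 ht' hη hi
    have h2 := norm_nonneg (η 0 - η (-t))
    simp only [V]
    linarith
  -- `K` bounds the energy at the slow edges, and must not depend on the maximal speed `R`.
  obtain ⟨P₀, -, hP₀⟩ := hH.exists_norm_le_of_lagrangian_eq (2 * (V / t))
  obtain ⟨K, hK0, hK⟩ := hH.exists_abs_le hX P₀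
  obtain ⟨C, hC0, hC⟩ := hH.exists_neg_le hX
  set R := max (2 * (V / t)) (2 * (V * (K + C)) / ε) + 1
  have hVt : 0 ≤ V / t := by positivity
  have hR0 : 0 < R := by
    have : 2 * (V / t) ≤ max (2 * (V / t)) (2 * (V * (K + C)) / ε) := le_max_left _ _
    simp only [R]
    linarith
  have hR₁ : 2 * V ≤ R * t := by
    have : 2 * (V / t) ≤ R := (le_max_left _ _).trans (lt_add_one _).le
    rwa [mul_div_assoc', div_le_iff₀ ht] at this
  have hR₂ : 2 * (V * (K + C)) ≤ R * ε := by
    have : 2 * (V * (K + C)) / ε ≤ R := (le_max_right _ _).trans (lt_add_one _).le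
    rwa [div_le_iff₀ hε] at this
  obtain ⟨P, -, hP⟩ := hH.exists_norm_le_of_lagrangian_eq R
  refine ⟨R, fun δ hδ => ?_⟩
  set ω := ε / (2 * t)
  have hω : 0 < ω := by positivity
  obtain ⟨δ₁, hδ₁, hmod⟩ := hH.exists_modulus hX P hω
  obtain ⟨δ₂, hδ₂, huc₂⟩ := Metric.uniformContinuousOn_iff.1
    (isCompact_Icc.uniformContinuousOn_of_continuous hγc) δ₁ hδ₁
  obtain ⟨δ₃, hδ₃, huc₃⟩ := Metric.uniformContinuousOn_iff.1
    (isCompact_Icc.uniformContinuousOn_of_continuous hηc) (R * (δ / 2)) (by positivity)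
  have hm : 0 < min (min δ₂ δ₃) (δ / 2) := by positivity
  obtain ⟨n, hn⟩ := exists_nat_gt (t / min (min δ₂ δ₃) (δ / 2))
  have hn0 : (0 : ℝ) < n := (div_pos ht hm).trans hn
  set h := t / n
  have hh0 : 0 < h := by positivity
  have hnh : n * h = t := mul_div_cancel₀ _ hn0.ne'
  have hh : h < min (min δ₂ δ₃) (δ / 2) := by
    rw [div_lt_iff₀ hm] at hn
    rwa [div_lt_iff₀ hn0, mul_comm]
  rw [lt_min_iff, lt_min_iff] at hh
  obtain ⟨⟨hh₂, hh₃⟩, hhδ⟩ := hh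
  set τ : ℕ → ℝ := fun k => -t + k * h
  have hτs : ∀ k, τ (k + 1) = τ k + h := fun k => by simp only [τ]; push_cast; ring
  have hτ0 : τ 0 = -t := by simp [τ]
  have hτn : τ n = 0 := by simp only [τ]; linarith
  have hτmem : ∀ k ≤ n, τ k ∈ Set.Icc (-t) 0 := fun k hk => by
    have hk' : (k : ℝ) ≤ n := by exact_mod_cast hk
    have h1 : (k : ℝ) * h ≤ n * h := by gcongr
    have h2 : 0 ≤ (k : ℝ) * h := by positivity
    constructor <;> simp only [τ] <;> linarith
  set x : ℕ → Euc N := fun k => η (τ k)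
  have hsub : ∀ k < n, Set.Icc (τ k) (τ (k + 1)) ⊆ Set.Icc (-t) 0 := fun k hk =>
    Set.Icc_subset_Icc (hτmem k hk.le).1 (hτmem (k + 1) hk).2
  have hle : ∀ k, τ k ≤ τ (k + 1) := fun k => by rw [hτs]; linarith
  have hsub' : ∀ k < n, Set.uIcc (τ k) (τ (k + 1)) ⊆ Set.uIcc (-t) 0 := fun k hk => by
    rw [Set.uIcc_of_le (hle k), Set.uIcc_of_le ht']
    exact hsub k hk
  have hik : ∀ k < n, IntervalIntegrable (runningCost H π η) volume (τ k) (τ (k + 1)) :=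
    fun k hk => hi.mono_set (hsub' k hk)
  have hsum : ∑ k ∈ Finset.range n, ∫ s in τ k..τ (k + 1), runningCost H π η s = I := by
    rw [intervalIntegral.sum_integral_adjacent_intervals hik, hτ0, hτn]
  have hsumh : ∑ _k ∈ Finset.range n, h = t := by simp [hnh]
  set S := ∑ k ∈ Finset.range n, ‖x (k + 1) - x k‖ with hS
  have hS0 : 0 ≤ S := Finset.sum_nonneg fun _ _ => norm_nonneg _
  have hSV : S ≤ V := by
    have h1 : S ≤ ∑ k ∈ Finset.range n, ((∫ s in τ k..τ (k + 1), runningCost H π η s) + C₁ * h) :=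
      Finset.sum_le_sum fun k hk => by
        have hk := Finset.mem_range.1 hk
        have := hC₁ η _ _ (hle k) (hη.mono (hsub' k hk)) (hik k hk)
        rw [hτs, add_sub_cancel_left, one_mul, ← hτs] at this
        simp only [x]
        linarith
    rwa [Finset.sum_add_distrib, hsum, ← Finset.mul_sum, hsumh] at h1
  set θ := S / (R * t)
  have hθ0 : 0 ≤ θ := by positivity
  have hθ1 : θ ≤ 1 / 2 := by
    rw [div_le_iff₀ (by positivity)]
    linarith
  have hθt : θ * t = S / R := by simp only [θ]; field_simp
  set σ : ℕ → ℝ := fun k => (1 - θ) * h + ‖x (k + 1) - x k‖ / R with hσ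
  have hσh : ∀ k, h / 2 ≤ σ k := fun k => by
    have h1 : 0 ≤ ‖x (k + 1) - x k‖ / R := by positivity
    simp only [σ]
    nlinarith
  have hσ0 : ∀ k, 0 < σ k := fun k => (by positivity : 0 < h / 2).trans_le (hσh k)
  have hxv : ∀ k, x (k + 1) - x k = σ k • (σ k)⁻¹ • (x (k + 1) - x k) := fun k =>
    (smul_inv_smul₀ (hσ0 k).ne' _).symm
  have hvn : ∀ k, ‖(σ k)⁻¹ • (x (k + 1) - x k)‖ = ‖x (k + 1) - x k‖ / σ k := fun k => by
    rw [norm_smul, norm_inv, Real.norm_of_nonneg (hσ0 k).le, inv_mul_eq_div]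
  have hvR : ∀ k, ‖(σ k)⁻¹ • (x (k + 1) - x k)‖ ≤ R := fun k => by
    rw [hvn, div_le_iff₀ (hσ0 k)]
    have h1 : R * σ k = R * ((1 - θ) * h) + ‖x (k + 1) - x k‖ := by simp only [σ]; field_simp
    have h2 : 0 ≤ R * ((1 - θ) * h) := mul_nonneg hR0.le (mul_nonneg (by linarith) hh0.le)
    linarith
  refine ⟨n, x, fun k => (σ k)⁻¹ • (x (k + 1) - x k), σ, by simp [x, hτ0], by simp [x, hτn],
    fun k hk => ⟨⟨τ k, hτmem k hk.le, rfl⟩, (hσ0 k).le, ?_, hvR k, ?_⟩, ?_, ?_⟩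
  · have h1 := huc₃ (τ (k + 1)) (hτmem _ hk) (τ k) (hτmem k hk.le)
      (by rw [hτs, Real.dist_eq, add_sub_cancel_left, abs_of_pos hh0]; exact hh₃)
    rw [dist_eq_norm, ← div_lt_iff₀' hR0] at h1
    have h2 : 0 ≤ θ * h := by positivity
    simp only [σ, x]
    linarith
  · rw [← hxv, add_sub_cancel]
  · simp only [hσ]
    rw [Finset.sum_add_distrib, ← Finset.mul_sum, hsumh, ← Finset.sum_div, ← hS]
    linarith
  · have hedge : ∀ k ∈ Finset.range n, σ k * lagrangian H (π (x k)) ((σ k)⁻¹ • (x (k + 1) - x k)) ≤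
        (∫ s in τ k..τ (k + 1), runningCost H π η s) + ω * h +
          (θ * K * h + C * (‖x (k + 1) - x k‖ / R)) := fun k hk => by
      have hk := Finset.mem_range.1 hk
      have hxX : π (x k) ∈ X := ⟨τ k, hτmem k hk.le, rfl⟩
      obtain ⟨p, hp⟩ := hH.exists_lagrangian_eq (π (x k)) ((σ k)⁻¹ • (x (k + 1) - x k))
      have h1 := hH.mul_lagrangian_le_integral (ω := ω) (hle k) (hη.mono (hsub' k hk))
        (hik k hk) (hxv k) hp fun s hs => hmod _ ⟨s, hsub k hk hs, rfl⟩ _ hxX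
          (huc₂ s (hsub k hk hs) _ (hτmem k hk.le) (by
            rw [hτs] at hs
            rw [Real.dist_eq, abs_of_nonneg (by linarith [hs.1])]
            linarith [hs.2])) p (hP _ _ (hvR k) p hp)
      have e1 : τ (k + 1) - τ k = h := by rw [hτs]; ring
      rw [e1] at h1
      refine h1.trans (add_le_add_right ?_ _)
      have e2 : h - σ k = θ * h - ‖x (k + 1) - x k‖ / R := by simp only [σ]; ring
      rw [e2]
      set y := ‖x (k + 1) - x k‖ / R with hy
      have hy0 : 0 ≤ y := by positivity
      have hθh : 0 ≤ θ * h := by positivity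
      have hCp := hC _ hxX p
      change (θ * h - y) * H (π (x k)) p ≤ _
      have hKC := sub_mul_le_of_imp hθh hy0 hK0 hC0 hCp fun hcase => by
        -- The edge is slow, so that its dual momentum is bounded independently of `R`.
        have h2 : ‖(σ k)⁻¹ • (x (k + 1) - x k)‖ ≤ 2 * (V / t) := by
          rw [hvn, div_le_iff₀ (hσ0 k)]
          have h3 : ‖x (k + 1) - x k‖ = R * y := (mul_div_cancel₀ _ hR0.ne').symm
          have h4 : R * θ = S / t := by simp only [θ]; field_simp
          calc ‖x (k + 1) - x k‖ ≤ R * (θ * h) := by rw [h3]; gcongr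
            _ = S / t * h := by rw [← h4]; ring
            _ ≤ V / t * h := by gcongr
            _ = 2 * (V / t) * (h / 2) := by ring
            _ ≤ 2 * (V / t) * σ k := by gcongr; exact hσh k
        exact (abs_le.1 (hK _ hxX p (hP₀ _ _ h2 p hp))).2
      linarith
    refine (Finset.sum_le_sum hedge).trans ?_
    rw [Finset.sum_add_distrib, Finset.sum_add_distrib, Finset.sum_add_distrib, hsum,
      ← Finset.mul_sum, ← Finset.mul_sum, ← Finset.mul_sum, hsumh, ← Finset.sum_div, ← hS]
    have h1 : ω * t = ε / 2 := by simp only [ω]; field_simp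
    have h2 : θ * K * t + C * (S / R) = S * (K + C) / R := by
      rw [mul_right_comm, hθt]; ring
    have h3 : S * (K + C) / R ≤ ε / 2 := by
      rw [div_le_iff₀ hR0]
      have : S * (K + C) ≤ V * (K + C) := by gcongr
      linarith
    linarith

end Discretization

/-! ### The semigroup of the maximum of two commuting Hamiltonians -/

section Maximum

variable {N : ℕ} {M : Type} [SeminormedAddCommGroup M] {H₁ H₂ : M → Euc N → ℝ} {π : Euc N → M}
  {u : M → EReal}

/-- Commutation and the semigroup property regroup the times spent with each Hamiltonian. -/
lemma Commute.laxOleinik_add_add (hcomm : Commute π H₁ H₂) (h₁ : IsConvexHamiltonian H₁)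
    (h₂ : IsConvexHamiltonian H₂) (hπ : IsProjection π) (hu : Admissible u) {a b c d : ℝ}
    (ha : 0 ≤ a) (hb : 0 ≤ b) (hc : 0 ≤ c) (hd : 0 ≤ d) :
    laxOleinik π H₁ (a + c) (laxOleinik π H₂ (b + d) u) =
      laxOleinik π H₁ c (laxOleinik π H₂ d (laxOleinik π H₁ a (laxOleinik π H₂ b u))) := by
  have hu₂ := hu.laxOleinik h₂ hπ hb
  rw [← laxOleinik_laxOleinik hπ h₁ ha hc (hu.laxOleinik h₂ hπ (by positivity)),
    ← laxOleinik_laxOleinik hπ h₂ hb hd hu, hcomm.laxOleinik_comm hπ hd ha hu₂]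

/-- Along a short edge with velocity `v`, the cost given by the Lagrangian of `max H₁ H₂` is almost
achieved by moving for a part of the time at the cost given by `H₁`, and for the rest of the time
at the cost given by `H₂`. -/
lemma Commute.exists_forall_edge (hcomm : Commute π H₁ H₂) (h₁ : IsConvexHamiltonian H₁)
    (h₂ : IsConvexHamiltonian H₂) (hπ : IsProjection π) (r R : ℝ) {ε : ℝ} (hε : 0 < ε) :
    ∃ δ > 0, ∀ u : M → EReal, Admissible u → ∀ x v : Euc N, ‖x‖ ≤ r → ‖v‖ ≤ R →
      ∀ σ a b : ℝ, 0 ≤ σ → σ < δ → 0 ≤ a → 0 ≤ b →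
      ∃ a' b' : ℝ, 0 ≤ a' ∧ 0 ≤ b' ∧ a' + b' = a + b + σ ∧
        laxOleinik π H₁ a' (laxOleinik π H₂ b' u) (π (x + σ • v)) ≤
          laxOleinik π H₁ a (laxOleinik π H₂ b u) (π x) +
            ((σ * (lagrangian (fun x p => max (H₁ x p) (H₂ x p)) (π x) v + ε) : ℝ) : EReal) := by
  have hX := isCompact_closedBall (0 : Euc N) (r + 1)
  have h₁' := h₁.lift hπ.continuous
  have h₂' := h₂.lift hπ.continuous
  obtain ⟨Q, hQ0, hQ⟩ := h₁'.exists_split_velocity h₂' hX R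
  obtain ⟨δ₁, hδ₁, hmod₁⟩ := h₁'.exists_lagrangian_modulus hX Q hε
  obtain ⟨δ₂, hδ₂, hmod₂⟩ := h₂'.exists_lagrangian_modulus hX Q hε
  refine ⟨min (min δ₁ δ₂) 1 / (Q + 1), by positivity,
    fun u hu x v hx hv σ a b hσ hσδ ha hb => ?_⟩
  have hxX : x ∈ Metric.closedBall (0 : Euc N) (r + 1) := by
    rw [mem_closedBall_zero_iff]; linarith
  have hσQ : σ * Q < min (min δ₁ δ₂) 1 := by
    rw [lt_div_iff₀ (by positivity)] at hσδ
    linarith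
  rw [lt_min_iff, lt_min_iff] at hσQ
  obtain ⟨⟨hσ₁, hσ₂⟩, hσ₃⟩ := hσQ
  obtain ⟨l, q₁, q₂, hl0, hl1, hq₁, hq₂, hlv, hL⟩ := hQ x hxX v hv
  have hl1' : 0 ≤ 1 - l := by linarith
  have hnear : ∀ z : Euc N, ‖z‖ ≤ σ * Q → x + z ∈ Metric.closedBall (0 : Euc N) (r + 1) ∧
      dist (x + z) x ≤ σ * Q := fun z hz => by
    rw [mem_closedBall_zero_iff, dist_eq_norm, add_sub_cancel_left]
    exact ⟨(norm_add_le _ _).trans (by linarith), hz⟩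
  set w := laxOleinik π H₁ a (laxOleinik π H₂ b u)
  set y := x + ((1 - l) * σ) • q₂ with hy
  -- first along `q₂`, at the cost given by `H₂`
  have e₂ : laxOleinik π H₂ ((1 - l) * σ) w (π y) ≤
      w (π x) + (((1 - l) * σ * (lagrangian H₂ (π x) q₂ + ε) : ℝ) : EReal) := by
    refine laxOleinik_le_segment hπ h₂ (by positivity) fun s hs0 hs => ?_
    have hz : ‖s • q₂‖ ≤ σ * Q := by
      rw [norm_smul, Real.norm_of_nonneg hs0]
      have : s ≤ σ := hs.trans (mul_le_of_le_one_left hσ (by linarith))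
      gcongr
    exact hmod₂ _ (hnear _ hz).1 x hxX ((hnear _ hz).2.trans_lt hσ₂) q₂ hq₂
  -- then along `q₁`, at the cost given by `H₁`
  have e₁ : laxOleinik π H₁ (l * σ) (laxOleinik π H₂ ((1 - l) * σ) w) (π (y + (l * σ) • q₁)) ≤
      laxOleinik π H₂ ((1 - l) * σ) w (π y) +
        ((l * σ * (lagrangian H₁ (π x) q₁ + ε) : ℝ) : EReal) := by
    refine laxOleinik_le_segment hπ h₁ (by positivity) fun s hs0 hs => ?_
    have hz : ‖((1 - l) * σ) • q₂ + s • q₁‖ ≤ σ * Q := by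
      refine (norm_add_le _ _).trans ?_
      rw [norm_smul, norm_smul, Real.norm_of_nonneg hs0, Real.norm_of_nonneg (by positivity)]
      calc (1 - l) * σ * ‖q₂‖ + s * ‖q₁‖ ≤ (1 - l) * σ * Q + l * σ * Q := by gcongr
        _ = σ * Q := by ring
    rw [hy, add_assoc]
    exact hmod₁ _ (hnear _ hz).1 x hxX ((hnear _ hz).2.trans_lt hσ₁) q₁ hq₁
  refine ⟨a + l * σ, b + (1 - l) * σ, by positivity, by positivity, by ring, ?_⟩
  have hend : x + σ • v = y + (l * σ) • q₁ := by
    rw [← hlv, hy]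
    module
  rw [hcomm.laxOleinik_add_add h₁ h₂ hπ hu ha hb (by positivity) (by positivity), hend]
  refine e₁.trans ((add_le_add_left e₂ _).trans ?_)
  rw [add_assoc, ← EReal.coe_add]
  gcongr
  change l * lagrangian H₁ (π x) q₁ + (1 - l) * lagrangian H₂ (π x) q₂ ≤
    lagrangian (fun x p => max (H₁ x p) (H₂ x p)) (π x) v at hL
  have := mul_le_mul_of_nonneg_left hL hσ
  linarith

/-- The Lax-Oleinik operator of the maximum of two commuting Hamiltonians consists in sharing the
time optimally between the two Hamiltonians. -/
lemma Commute.laxOleinik_max (hcomm : Commute π H₁ H₂) (h₁ : IsConvexHamiltonian H₁)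
    (h₂ : IsConvexHamiltonian H₂) (hπ : IsProjection π) (hu : Admissible u) {t : ℝ} (ht : 0 ≤ t)
    (x : M) :
    laxOleinik π (fun x p => max (H₁ x p) (H₂ x p)) t u x =
      ⨅ r : Set.Icc 0 t, laxOleinik π H₁ r (laxOleinik π H₂ (t - r) u) x := by
  have hG := h₁.sup h₂
  refine le_antisymm (le_iInf fun ⟨r, hr0, hr⟩ => ?_) ?_
  · have htr : 0 ≤ t - r := by linarith
    have hle := laxOleinik_add_le hπ hG htr hr0 hu x
    rw [sub_add_cancel] at hle
    refine hle.trans ((laxOleinik_mono (fun y => laxOleinik_anti h₂ hG hπ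
      (fun _ _ => le_max_right _ _) htr hu y) x).trans ?_)
    exact laxOleinik_anti h₁ hG hπ (fun _ _ => le_max_left _ _) hr0 (hu.laxOleinik h₂ hπ htr) x
  rcases ht.eq_or_lt with rfl | ht0
  · refine (iInf_le _ ⟨0, le_rfl, le_rfl⟩).trans ?_
    simp only [sub_zero, laxOleinik_zero hπ, le_refl]
  refine le_laxOleinik hu.ne_bot fun η hη h0 hi => ?_
  set I := ∫ s in (-t)..0, runningCost (fun x p => max (H₁ x p) (H₂ x p)) π η s
  induction hc : u (π (η (-t))) with
  | bot => exact absurd hc (hu.ne_bot _)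
  | top => rw [EReal.top_add_coe]; exact le_top
  | coe c =>
  rw [← EReal.coe_add, ← EReal.le_of_forall_lt_iff_le]
  intro z hz
  rw [EReal.coe_lt_coe_iff] at hz
  set ε := (z - (c + I)) / (1 + t)
  have hε : 0 < ε := div_pos (by linarith) (by positivity)
  have hεz : c + (I + ε + t * ε) = z := by
    have : ε * (1 + t) = z - (c + I) := div_mul_cancel₀ _ (by positivity)
    linarith
  obtain ⟨R, hR⟩ := hG.exists_polygon hπ.continuous ht0 hη hi hε
  obtain ⟨r, hr⟩ := hη.exists_bound
  rw [Set.uIcc_of_le (by linarith)] at hr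
  obtain ⟨δ, hδ, hedge⟩ := hcomm.exists_forall_edge h₁ h₂ hπ r R hε
  obtain ⟨n, y, v, σ, hy0, hyn, hstep, hσ, hsum⟩ := hR δ hδ
  have hind : ∀ k ≤ n, ∃ a b : ℝ, 0 ≤ a ∧ 0 ≤ b ∧ a + b = ∑ j ∈ Finset.range k, σ j ∧
      laxOleinik π H₁ a (laxOleinik π H₂ b u) (π (y k)) ≤
        u (π (y 0)) + ((∑ j ∈ Finset.range k,
          σ j * (lagrangian (fun x p => max (H₁ x p) (H₂ x p)) (π (y j)) (v j) + ε) : ℝ) :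
            EReal) := by
    intro k
    induction k with
    | zero => exact fun _ => ⟨0, 0, le_rfl, le_rfl, by simp, by simp [laxOleinik_zero hπ]⟩
    | succ k ih =>
      intro hk
      obtain ⟨a, b, ha, hb, hab, hle⟩ := ih (by lia)
      obtain ⟨⟨s, hs, hys⟩, hσ0, hσδ, hv, hy⟩ := hstep k hk
      obtain ⟨a', b', ha', hb', hab', hle'⟩ := hedge u hu (y k) (v k) (hys ▸ hr s hs) hv (σ k) a b
        hσ0 hσδ ha hb
      refine ⟨a', b', ha', hb', by rw [hab', hab, Finset.sum_range_succ], ?_⟩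
      rw [hy, Finset.sum_range_succ, EReal.coe_add, ← add_assoc]
      exact hle'.trans (add_le_add_left hle _)
  obtain ⟨a, b, ha, hb, hab, hle⟩ := hind n le_rfl
  rw [hσ] at hab
  refine (iInf_le _ ⟨a, ha, by linarith⟩).trans ?_
  have hbt : t - a = b := by linarith
  simp only [hbt]
  rw [hyn, h0, hy0, hc, ← EReal.coe_add] at hle
  refine hle.trans ?_
  rw [EReal.coe_le_coe_iff, ← hεz]
  simp only [mul_add]
  rw [Finset.sum_add_distrib, ← Finset.sum_mul, hσ]
  linarith

/-- The maximum of two commuting Hamiltonians commutes with the first one. -/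
lemma Commute.max_left (hcomm : Commute π H₁ H₂) (h₁ : IsConvexHamiltonian H₁)
    (h₂ : IsConvexHamiltonian H₂) (hπ : IsProjection π) :
    Commute π (fun x p => max (H₁ x p) (H₂ x p)) H₁ := by
  intro u hu s t hs ht x
  have hG := hu.laxOleinik (h₁.sup h₂) hπ ht.le
  have h := fun y => hcomm.laxOleinik_max h₁ h₂ hπ hu ht.le y
  rw [hcomm.laxOleinik_max h₁ h₂ hπ (hu.laxOleinik h₁ hπ hs.le) ht.le, funext h,
    laxOleinik_iInf fun y => h y ▸ hG.ne_bot y]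
  refine iInf_congr fun ⟨r, hr0, hr⟩ => ?_
  have htr : 0 ≤ t - r := by linarith
  have hu₂ := hu.laxOleinik h₂ hπ htr
  dsimp only
  rw [hcomm.laxOleinik_comm hπ htr hs.le hu, laxOleinik_laxOleinik hπ h₁ hr0 hs.le hu₂,
    laxOleinik_laxOleinik hπ h₁ hs.le hr0 hu₂, add_comm]

lemma Commute.symm (hcomm : Commute π H₁ H₂) : Commute π H₂ H₁ :=
  fun u hu s t hs ht x => (hcomm u hu t s ht hs x).symm

/-- The maximum of two commuting Hamiltonians commutes with the second one. -/
lemma Commute.max_right (hcomm : Commute π H₁ H₂) (h₁ : IsConvexHamiltonian H₁)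
    (h₂ : IsConvexHamiltonian H₂) (hπ : IsProjection π) :
    Commute π (fun x p => max (H₁ x p) (H₂ x p)) H₂ := by
  simpa only [max_comm] using hcomm.symm.max_left h₂ h₁ hπ

end Maximum

lemma isProjection_id (N : ℕ) : IsProjection (id : Euc N → Euc N) where
  map_add _ _ := rfl
  norm_le _ := le_rfl
  surjective := Function.surjective_id

lemma isProjection_torusProj (N : ℕ) : IsProjection (torusProj N) where
  map_add _ _ := rfl
  norm_le _ := QuotientAddGroup.norm_mk_le_norm
  surjective := QuotientAddGroup.mk_surjective

end HJ

theorem mainTheorem6 (N : ℕ) :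
    (∀ H₁ H₂ : HJ.Euc N → HJ.Euc N → ℝ,
      HJ.IsConvexHamiltonian H₁ → HJ.IsConvexHamiltonian H₂ →
      HJ.Commute id H₁ H₂ →
      HJ.IsConvexHamiltonian (fun x p => max (H₁ x p) (H₂ x p)) ∧
      HJ.Commute id (fun x p => max (H₁ x p) (H₂ x p)) H₁ ∧
      HJ.Commute id (fun x p => max (H₁ x p) (H₂ x p)) H₂) ∧
    (∀ H₁ H₂ : HJ.Torus N → HJ.Euc N → ℝ,
      HJ.IsConvexHamiltonian H₁ → HJ.IsConvexHamiltonian H₂ →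
      HJ.Commute (HJ.torusProj N) H₁ H₂ →
      HJ.IsConvexHamiltonian (fun x p => max (H₁ x p) (H₂ x p)) ∧
      HJ.Commute (HJ.torusProj N) (fun x p => max (H₁ x p) (H₂ x p)) H₁ ∧
      HJ.Commute (HJ.torusProj N) (fun x p => max (H₁ x p) (H₂ x p)) H₂) := by
  exact ⟨fun H₁ H₂ h₁ h₂ hcomm => ⟨h₁.sup h₂, hcomm.max_left h₁ h₂ (HJ.isProjection_id N),
      hcomm.max_right h₁ h₂ (HJ.isProjection_id N)⟩,
    fun H₁ H₂ h₁ h₂ hcomm => ⟨h₁.sup h₂, hcomm.max_left h₁ h₂ (HJ.isProjection_torusProj N),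
      hcomm.max_right h₁ h₂ (HJ.isProjection_torusProj N)⟩⟩
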